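/- **Power system.** Let $\dot x=f(x,u,w)$, $\Delta\omega=h(x,u,w)$ with state $x\in\mathbb R^n$, input $u\in\mathbb R^m$, output $\Delta\omega\in\mathbb R^m$ and constant exogenous signal $w\in\mathbb R^{q}$. Suppose there are domains (nonempty open connected sets) $\mathcal X\subseteq\mathbb R^n$ and $\mathcal I\subseteq\mathbb R^m\times\mathbb R^{q}$ such that: (1) $f$ and $h$ are Lipschitz continuous on $\mathcal X\times\mathcal I$; (2) there is a differentiable, Lipschitz continuous map $\pi_x:\mathcal I\to\mathcal X$ with $f(\pi_x(u,w),u,w)=0$ for all $(u,w)\in\mathcal I$; (3) there are $c_1,c_2,c_3,c_4>0$ and $V:\mathcal X\times\mathcal I\to\mathbb R_{\ge0}$, continuously differentiable in $(x,u)$, such that for all $x\in\mathcal X$, $(u,w)\in\mathcal I$: $c_1\|x-\pi_x(u,w)\|_2^2\le V(x,u,w)\le c_2\|x-\pi_x(u,w)\|_2^2$, $\nabla_xV(x,u,w)^{\mathsf T}f(x,u,w)\le-c_3\|x-\pi_x(u,w)\|_2^2$ and $\|\nabla_uV(x,u,w)\|_2\le c_4\|x-\pi_x(u,w)\|_2$;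 (4) $h(\pi_x(u,w),u,w)=\frac1\beta\mathbf 1(\mathbf 1^{\mathsf T}u-d)$ for all $(u,w)\in\mathcal I$, where $\beta>0$ and $d=d(w)\in\mathbb R$ is the net load disturbance belonging to $w$. **Costs.** For $i=1,\dots,m$ let $\mathcal U_i=(\underline u_i,\overline u_i)$ with $-\infty\le\underline u_i<\overline u_i\le+\infty$, and let $J_i:\mathcal U_i\to\mathbb R_{\ge0}$ be continuously differentiable, strongly convex (for some $\mu_i>0$, $(J_i'(x)-J_i'(y))(x-y)\ge\mu_i|x-y|^2$ on $\mathcal U_i$), with $J_i(\xi)\to+\infty$ as $\xi\searrow\underline u_i$ and as $\xi\nearrow\overline u_i$. Consider the resource-allocation problem $$\text{minimize } \sum_{i=1}^m J_i(u_i)\quad\text{subject to}\quad \mathbf 1^{\mathsf T}u-d=0,\quad u_i\in\mathcal U_i, \tag{P}$$ for $d=d(w)$. Assume that (P) is feasible, and that every optimizer $u$ of (P) satisfies $(u,w)\in\mathcal I$ (the optimal operating point lies in the domain of the model). Let $J_i^*(p)=\sup_{\xi\in\mathcal U_i}(p\xi-J_i(\xi))$ and $\nabla J^*(\eta)=((J_1^*)'(\eta_1),\dots,(J_m^*)'(\eta_m))$.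 **Controller.** Let $\mathcal G$ be a weighted directed graph on $\{1,\dots,m\}$ with weights $a_{ij}\ge0$ and edges $(i,j)$ where $a_{ij}>0$, and let $\mathsf L$ be its Laplacian, $\ell_{ij}=-a_{ij}$ for $i\ne j$, $\ell_{ii}=\sum_{l\ne i}a_{il}$. For $\tau>0$ close the loop with the DAPI controller $$\tau\dot\eta=-\Delta\omega-\mathsf L\eta,\qquad u=\nabla J^*(\eta).$$ **Theorem.** Each $J_i^*$ is finite and differentiable on $\mathbb R$, so the controller is well defined. If $\mathcal G$ has a globally reachable node (a node $i$ such that from every $j\ne i$ there is a directed path to $i$), then there is $\tau^\star>0$ such that for every $\tau\ge\tau^\star$ the closed-loop system has exactly one equilibrium $(\bar x,\bar\eta)$ with $\bar x\in\mathcal X$ and $(\nabla J^*(\bar\eta),w)\in\mathcal I$; this equilibrium is (locally) asymptotically stable, and $\bar u=\nabla J^*(\bar\eta)$ is the unique global optimizer of (P). -/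

import Mathlib

open Set Filter Topology

noncomputable section

namespace DAPI

/-- `ℝᵏ` with the Euclidean norm. -/
abbrev Vec (k : ℕ) := EuclideanSpace ℝ (Fin k)

/-! ## Weighted directed graphs -/

/-- A weighted directed graph on the nodes `Fin m`, given by its nonnegative adjacency matrix. -/
structure WeightedDigraph (m : ℕ) where
  /-- the adjacency matrix `(a i j)` -/
  a : Matrix (Fin m) (Fin m) ℝ
  nonneg : ∀ i j, 0 ≤ a i j

namespace WeightedDigraph

variable {m : ℕ}

/-- `(i, j)` is a directed edge iff its weight is positive. -/
def Edge (G : WeightedDigraph m) (i j : Fin m) : Prop := 0 < G.a i j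

/-- Node `i` is globally reachable: from every other node there is a directed path to `i`. -/
def GloballyReachable (G : WeightedDigraph m) (i : Fin m) : Prop :=
  ∀ j, j ≠ i → Relation.TransGen G.Edge j i

/-- The Laplacian matrix. -/
def laplacian (G : WeightedDigraph m) : Matrix (Fin m) (Fin m) ℝ :=
  Matrix.of fun i j =>
    if i = j then ∑ l ∈ Finset.univ.erase i, G.a i l else -G.a i j

end WeightedDigraph

/-! ## The power system model -/

/-- The power system `ẋ = f(x,u,w)`, `Δω = h(x,u,w)` on the domains `X` (states) and
`I` (pairs input / disturbance): `f` and `h` are Lipschitz, `π` is the equilibrium map, there is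
a quadratic Lyapunov function for `π (u, w)`, uniformly over `(u, w) ∈ I`, and the steady-state
frequency deviation is `β⁻¹ 𝟏 (𝟏ᵀ u - d)`.
The net load disturbance `d` is the constant `d w` belonging to the constant exogenous signal
`w`. -/
structure PowerSystemAssumption {n m q : ℕ}
    (f : Vec n → Vec m → Vec q → Vec n) (h : Vec n → Vec m → Vec q → Vec m)
    (X : Set (Vec n)) (I : Set (Vec m × Vec q)) (π : Vec m × Vec q → Vec n)
    (β : ℝ) (d : Vec q → ℝ) : Prop where
  isOpen_X : IsOpen X
  isConnected_X : IsConnected X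
  isOpen_I : IsOpen I
  isConnected_I : IsConnected I
  lipschitz_f : ∃ K, LipschitzOnWith K
    (fun p : Vec n × (Vec m × Vec q) => f p.1 p.2.1 p.2.2) (X ×ˢ I)
  lipschitz_h : ∃ K, LipschitzOnWith K
    (fun p : Vec n × (Vec m × Vec q) => h p.1 p.2.1 p.2.2) (X ×ˢ I)
  mapsTo_π : MapsTo π I X
  differentiable_π : DifferentiableOn ℝ π I
  lipschitz_π : ∃ K, LipschitzOnWith K π I
  equilibrium_π : ∀ u w, (u, w) ∈ I → f (π (u, w)) u w = 0
  /-- Here `fderiv` of a partial function applied to a vector is the pairing of the partial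
  gradient with that vector, and its operator norm is the Euclidean norm of that gradient. -/
  lyapunov : ∃ (V : Vec n → Vec m → Vec q → ℝ) (c₁ c₂ c₃ c₄ : ℝ),
    0 < c₁ ∧ 0 < c₂ ∧ 0 < c₃ ∧ 0 < c₄ ∧
    (∀ w, ContDiffOn ℝ 1 (fun p : Vec n × Vec m => V p.1 p.2 w)
      {p | p.1 ∈ X ∧ (p.2, w) ∈ I}) ∧
    ∀ x ∈ X, ∀ u w, (u, w) ∈ I →
      0 ≤ V x u w ∧
      c₁ * ‖x - π (u, w)‖ ^ 2 ≤ V x u w ∧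
      V x u w ≤ c₂ * ‖x - π (u, w)‖ ^ 2 ∧
      fderiv ℝ (fun x' => V x' u w) x (f x u w) ≤ -c₃ * ‖x - π (u, w)‖ ^ 2 ∧
      ‖fderiv ℝ (fun u' => V x u' w) u‖ ≤ c₄ * ‖x - π (u, w)‖
  β_pos : 0 < β
  steadyState : ∀ u w, (u, w) ∈ I → ∀ i, h (π (u, w)) u w i = (1 / β) * (∑ j, u j - d w)

/-! ## Costs and the resource-allocation problem -/

/-- The open interval `(lo, hi)` of real numbers, with endpoints in `[-∞, +∞]`. -/
def openInterval (lo hi : EReal) : Set ℝ := {ξ | lo < (ξ : EReal) ∧ (ξ : EReal) < hi}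

/-- A nonnegative, continuously differentiable, strongly convex cost on `(lo, hi)` which tends to
`+∞` at both (finite or infinite) endpoints. -/
structure CostAssumption (lo hi : EReal) (J : ℝ → ℝ) : Prop where
  lo_lt_hi : lo < hi
  nonneg : ∀ ξ ∈ openInterval lo hi, 0 ≤ J ξ
  contDiff : ContDiffOn ℝ 1 J (openInterval lo hi)
  stronglyConvex : ∃ μ > 0, ∀ x ∈ openInterval lo hi, ∀ y ∈ openInterval lo hi,
    μ * |x - y| ^ 2 ≤ (deriv J x - deriv J y) * (x - y)
  barrier_lo : Tendsto J (comap (fun ξ : ℝ => (ξ : EReal)) (𝓝[>] lo)) atTop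
  barrier_hi : Tendsto J (comap (fun ξ : ℝ => (ξ : EReal)) (𝓝[<] hi)) atTop

/-- The values `p ξ - J ξ`, `ξ ∈ (lo, hi)`, whose supremum is the conjugate at `p`. -/
def conjValues (lo hi : EReal) (J : ℝ → ℝ) (p : ℝ) : Set ℝ :=
  (fun ξ => p * ξ - J ξ) '' openInterval lo hi

/-- The convex conjugate `J*(p) = sup_{ξ ∈ (lo, hi)} (p ξ - J ξ)`. -/
def conj (lo hi : EReal) (J : ℝ → ℝ) (p : ℝ) : ℝ := sSup (conjValues lo hi J p)

/-- The gradient `∇J*(η) = (∇J₁*(η₁), …, ∇J_m*(η_m))` of `J*(η) = ∑ i, J_i*(η_i)`. -/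
def gradConj {m : ℕ} (lo hi : Fin m → EReal) (J : Fin m → ℝ → ℝ) (η : Vec m) : Vec m :=
  WithLp.toLp 2 fun i => deriv (conj (lo i) (hi i) (J i)) (η i)

/-- Feasibility for: minimize `∑ i, J_i(u_i)` subject to `0 = 𝟏ᵀ u - d`, with
`u_i ∈ (lo i, hi i)` implicit in the domain of `J_i`. -/
def IsFeasible {m : ℕ} (lo hi : Fin m → EReal) (d : ℝ) (u : Vec m) : Prop :=
  (∀ i, u i ∈ openInterval (lo i) (hi i)) ∧ 0 = ∑ i, u i - d

/-- `u` is a global optimizer of the resource-allocation problem. -/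
def IsOptimizer {m : ℕ} (lo hi : Fin m → EReal) (J : Fin m → ℝ → ℝ) (d : ℝ) (u : Vec m) : Prop :=
  IsFeasible lo hi d u ∧ ∀ v, IsFeasible lo hi d v → ∑ i, J i (u i) ≤ ∑ i, J i (v i)

/-! ## Closed loop and stability -/

/-- The closed-loop vector field in `(x, η)`:
`ẋ = f(x,u,w)`, `τ η̇ = -h(x,u,w) - L η`, `u = ∇J*(η)`. -/
def closedLoop {n m q : ℕ}
    (f : Vec n → Vec m → Vec q → Vec n) (h : Vec n → Vec m → Vec q → Vec m)
    (G : WeightedDigraph m) (lo hi : Fin m → EReal) (J : Fin m → ℝ → ℝ) (w : Vec q) (τ : ℝ)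
    (p : Vec n × Vec m) : Vec n × Vec m :=
  (f p.1 (gradConj lo hi J p.2) w,
    τ⁻¹ • (-h p.1 (gradConj lo hi J p.2) w
      - WithLp.toLp 2 (G.laplacian.mulVec (WithLp.ofLp p.2))))

/-- `z` solves `ż = F z` on the time set `S` (one-sided derivatives at endpoints). -/
def IsSolutionOn {E : Type*} [NormedAddCommGroup E] [NormedSpace ℝ E]
    (F : E → E) (z : ℝ → E) (S : Set ℝ) : Prop :=
  ∀ t ∈ S, HasDerivWithinAt z (F (z t)) S t

/-- (Local, Lyapunov) asymptotic stability of the equilibrium `e` of `ż = F z`: solutions that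
start near `e` exist for all positive times, stay near `e` and converge to `e`. -/
structure IsAsymptoticallyStable {E : Type*} [NormedAddCommGroup E] [NormedSpace ℝ E]
    (F : E → E) (e : E) : Prop where
  exists_solution : ∃ δ > 0, ∀ z₀, ‖z₀ - e‖ < δ →
    ∃ z : ℝ → E, z 0 = z₀ ∧ IsSolutionOn F z (Ici 0)
  stable : ∀ ε > 0, ∃ δ > 0, ∀ (T : ℝ) (z : ℝ → E), IsSolutionOn F z (Ico 0 T) →
    ‖z 0 - e‖ < δ → ∀ t ∈ Ico 0 T, ‖z t - e‖ < ε
  attractive : ∃ δ > 0, ∀ z : ℝ → E, IsSolutionOn F z (Ici 0) →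
    ‖z 0 - e‖ < δ → Tendsto z atTop (𝓝 e)

/-- `(x, η)` is an equilibrium of the closed loop within the domain of the model. -/
def IsEquilibrium {n m q : ℕ}
    (f : Vec n → Vec m → Vec q → Vec n) (h : Vec n → Vec m → Vec q → Vec m)
    (X : Set (Vec n)) (I : Set (Vec m × Vec q))
    (G : WeightedDigraph m) (lo hi : Fin m → EReal) (J : Fin m → ℝ → ℝ) (w : Vec q) (τ : ℝ)
    (p : Vec n × Vec m) : Prop :=
  p.1 ∈ X ∧ (gradConj lo hi J p.2, w) ∈ I ∧ closedLoop f h G lo hi J w τ p = 0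

end DAPI

end

/-! Equilibria. At a zero of `f` the decay inequality for `V` forces `x = π (u, w)`, so the output
is a multiple of `𝟏`. Some linear functional `ζ` vanishes on the range of the Laplacian `L` and
takes the value 1 at `𝟏`; applying it to the controller equation gives zero imbalance, and then `L η
= 0`, hence `η = s 𝟏` by reachability. Since each `ψ i`, the inverse of the marginal cost, is
strictly increasing, only one common price `s` balances `∑ ψ i s = d`; it exists by feasibility.
Equal marginal costs and the gradient inequality make the resulting allocation the unique optimizer.

Stability. For large `τ` the controller is slow and the plant stays near `π (u, w)`. With `ε = 1/τ`,
the average price `ζ η` approximately follows a gradient descent on the negative dual function,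
whose derivative is the imbalance, while the disagreement is contracted by `-L`. The composite
function is `V` plus the dual gap at `ζ η` plus `κ N(η)²`, where the seminorm `N` measures
disagreement. Its decay is negative definite once `κ` is large and `ε` small: all cross terms are
absorbed by Young's inequality (`composite_rate_le`, `exists_controller_bounds`).

Two points shape the argument. The digraph need not be balanced, so `N` comes from row-stochastic
matrices: an Euler step of `-L` has a power with a positive column, which contracts the spread of
coordinates. And `∇J*` is only Lipschitz while `N` need not be smooth, so Lyapunov's method is run
with upper Dini derivatives (`isAsymptoticallyStable_of_decreasesAlong`). -/

namespace DAPI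

/-! ## Upper right Dini derivatives -/

/-- The upper right Dini derivative of `g` at `t` is at most `a`. -/
def UpperDini (g : ℝ → ℝ) (t a : ℝ) : Prop :=
  ∀ r > a, ∀ᶠ s in 𝓝[>] t, g s ≤ g t + r * (s - t)

namespace UpperDini

variable {g g₁ g₂ : ℝ → ℝ} {t a b : ℝ}

theorem mono (h : UpperDini g t a) (hab : a ≤ b) : UpperDini g t b :=
  fun r hr => h r (hab.trans_lt hr)

theorem add (h₁ : UpperDini g₁ t a) (h₂ : UpperDini g₂ t b) :
    UpperDini (fun s => g₁ s + g₂ s) t (a + b) := by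
  intro r hr
  filter_upwards [h₁ (a + (r - (a + b)) / 2) (by linarith),
    h₂ (b + (r - (a + b)) / 2) (by linarith)] with s hs₁ hs₂
  linarith

theorem const_mul (h : UpperDini g t a) {c : ℝ} (hc : 0 ≤ c) :
    UpperDini (fun s => c * g s) t (c * a) := by
  intro r hr
  rcases hc.eq_or_lt with rfl | hc
  · filter_upwards [self_mem_nhdsWithin] with s hs
    have : 0 < s - t := sub_pos.2 hs
    nlinarith
  · filter_upwards [h (r / c) (by rw [gt_iff_lt, lt_div_iff₀ hc]; linarith)] with s hs
    calc c * g s ≤ c * (g t + r / c * (s - t)) := by gcongr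
      _ = c * g t + r * (s - t) := by field_simp

/-- An upper bound that is attained at `t` transfers its Dini derivative. -/
theorem of_le (h : UpperDini g₁ t a) (hle : ∀ᶠ s in 𝓝[>] t, g s ≤ g₁ s) (heq : g t = g₁ t) :
    UpperDini g t a := by
  intro r hr
  filter_upwards [h r hr, hle] with s h1 h2
  rw [heq]
  exact h2.trans h1

theorem of_hasDerivWithinAt (h : HasDerivWithinAt g a (Ici t) t) : UpperDini g t a := by
  intro r hr
  have h1 := (hasDerivWithinAt_iff_tendsto_slope' (self_notMem_Ioi)).1 h.Ioi_of_Ici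
  filter_upwards [h1.eventually_lt_const hr, self_mem_nhdsWithin] with s hs hts
  have hts' : 0 < s - t := sub_pos.2 hts
  rw [slope_def_field, div_lt_iff₀ hts'] at hs
  linarith

theorem norm_sub {E : Type*} [NormedAddCommGroup E] [NormedSpace ℝ E] {z : ℝ → E} {z' : E}
    (h : HasDerivWithinAt z z' (Ici t) t) : UpperDini (fun s => ‖z s - z t‖) t ‖z'‖ := by
  intro r hr
  filter_upwards [h.Ioi_of_Ici.limsup_norm_slope_le hr, self_mem_nhdsWithin] with s hs hts
  have : 0 < s - t := sub_pos.2 hts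
  rw [Real.norm_of_nonneg this.le, inv_mul_lt_iff₀ this] at hs
  rw [sub_self, norm_zero]
  linarith

theorem sq (h : UpperDini g t a) (hg : ∀ s, 0 ≤ g s) (hc : ContinuousWithinAt g (Ici t) t) :
    UpperDini (fun s => g s ^ 2) t (2 * g t * a) := by
  intro r hr
  -- Factor `g s ^ 2 - g t ^ 2 = (g s - g t) * (g s + g t)`: the first factor is at most `r' * (s -
  -- t)`, the second tends to `2 * g t`.
  obtain ⟨r', har', hr'⟩ : ∃ r' > a, 2 * g t * r' < r := by
    have h1 : Tendsto (fun r' => 2 * g t * r') (𝓝[>] a) (𝓝 (2 * g t * a)) :=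
      (Continuous.tendsto (by fun_prop) a).mono_left nhdsWithin_le_nhds
    obtain ⟨r', h2, h3⟩ := ((h1.eventually_lt_const hr).and self_mem_nhdsWithin).exists
    exact ⟨r', h3, h2⟩
  have h2 : Tendsto (fun s => r' * (g s + g t)) (𝓝[>] t) (𝓝 (r' * (g t + g t))) :=
    ((hc.mono Ioi_subset_Ici_self).tendsto.add_const _).const_mul _
  filter_upwards [h r' har', h2.eventually_lt_const (show r' * (g t + g t) < r by linarith),
    self_mem_nhdsWithin] with s hs1 hs2 hts
  have hts' : 0 < s - t := sub_pos.2 hts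
  nlinarith [mul_le_mul_of_nonneg_right hs1 (add_nonneg (hg s) (hg t)),
    mul_le_mul_of_nonneg_right hs2.le hts'.le]

/-- The chain rule for a function that is differentiable in `(x, u)`, along a curve in `x` and the
Lipschitz image in `u` of a curve in `η`. -/
theorem comp_prodMk_lipschitz {E F H : Type*} [NormedAddCommGroup E] [NormedSpace ℝ E]
    [NormedAddCommGroup F] [NormedSpace ℝ F] [NormedAddCommGroup H] [NormedSpace ℝ H]
    {Φ : E × F → ℝ} {D : E × F →L[ℝ] ℝ} {φ : H → F} {K : NNReal} {x : ℝ → E} {x' : E}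
    {η : ℝ → H} {η' : H} (hΦ : HasFDerivAt Φ D (x t, φ (η t))) (hφ : LipschitzWith K φ)
    (hx : HasDerivWithinAt x x' (Ici t) t) (hη : HasDerivWithinAt η η' (Ici t) t) :
    UpperDini (fun s => Φ (x s, φ (η s))) t
      (D (x', 0) + ‖D ∘L ContinuousLinearMap.inr ℝ E F‖ * (K * ‖η'‖)) := by
  set z : ℝ → E × F := fun s => (x s, φ (η s)) with hz
  have hzc : ContinuousWithinAt z (Ici t) t :=
    hx.continuousWithinAt.prodMk (hφ.continuous.continuousAt.comp_continuousWithinAt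
      hη.continuousWithinAt)
  -- The curve `φ ∘ η` may fail to be differentiable, but its increments are still `O(s - t)`, which
  -- makes the Taylor remainder of `Φ` an `o(s - t)`.
  have hO : (fun s => z s - z t) =O[𝓝[Ici t] t] fun s => s - t := by
    refine hx.differentiableWithinAt.isBigO_sub.prod_left
      (Asymptotics.IsBigO.trans (g := fun s => η s - η t) ?_ hη.differentiableWithinAt.isBigO_sub)
    exact Asymptotics.IsBigO.of_bound K (Eventually.of_forall fun s => hφ.norm_sub_le _ _)
  have hrem : HasDerivWithinAt (fun s => Φ (z s) - Φ (z t) - D (z s - z t)) 0 (Ici t) t := by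
    rw [hasDerivWithinAt_iff_isLittleO]
    simpa using! (hΦ.isLittleO.comp_tendsto hzc).trans_isBigO hO
  have hD : HasDerivWithinAt (fun s => D (x s - x t, 0)) (D (x', 0)) (Ici t) t :=
    (D ∘L ContinuousLinearMap.inl ℝ E F).hasFDerivAt.comp_hasDerivWithinAt t (hx.sub_const (x t))
  have hsum := (((of_hasDerivWithinAt hrem).add (of_hasDerivWithinAt hD)).add
    (((norm_sub hη).const_mul K.coe_nonneg).const_mul
      (norm_nonneg (D ∘L ContinuousLinearMap.inr ℝ E F)))).add
    (of_hasDerivWithinAt (hasDerivWithinAt_const t (Ici t) (Φ (z t))))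
  refine (hsum.mono (by simp)).of_le (Eventually.of_forall fun s => ?_)
    (by simp [hz, Prod.mk_zero_zero])
  have h1 : D (z s - z t) = D (x s - x t, 0)
      + (D ∘L ContinuousLinearMap.inr ℝ E F) (φ (η s) - φ (η t)) := by
    rw [ContinuousLinearMap.comp_apply, ContinuousLinearMap.inr_apply, ← map_add]
    simp [hz]
  have h2 : (D ∘L ContinuousLinearMap.inr ℝ E F) (φ (η s) - φ (η t))
      ≤ ‖D ∘L ContinuousLinearMap.inr ℝ E F‖ * (K * ‖η s - η t‖) :=
    (le_abs_self _).trans (((D ∘L ContinuousLinearMap.inr ℝ E F).le_opNorm _).trans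
      (mul_le_mul_of_nonneg_left (hφ.norm_sub_le _ _) (norm_nonneg _)))
  change Φ (z s) ≤ _
  linarith

/-- The Dini derivative of a seminorm along a curve is its directional Dini derivative. -/
theorem seminorm_comp {E : Type*} [NormedAddCommGroup E] [NormedSpace ℝ E] {N : Seminorm ℝ E}
    {C : ℝ} (hC : 0 ≤ C) (hN : ∀ v, N v ≤ C * ‖v‖) {z : ℝ → E} {z' : E}
    (hz : HasDerivWithinAt z z' (Ici t) t)
    (h : ∀ᶠ s in 𝓝[>] t, N (z t + (s - t) • z') ≤ N (z t) + a * (s - t)) :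
    UpperDini (fun s => N (z s)) t a := by
  have hlin : HasDerivWithinAt (fun s => z t + (s - t) • z') z' (Ici t) t := by
    simpa using! (((hasDerivWithinAt_id t (Ici t)).sub_const t).smul_const z').const_add (z t)
  -- The curve minus its tangent line has derivative zero, so it adds nothing to the Dini
  -- derivative.
  have hd := (norm_sub (hz.sub hlin)).const_mul hC
  have ha : UpperDini (fun s => N (z t) + a * (s - t)) t a := by
    refine of_hasDerivWithinAt ?_
    simpa using! (((hasDerivWithinAt_id t (Ici t)).sub_const t).const_mul a).const_add (N (z t))
  refine ((ha.add hd).mono (by simp)).of_le ?_ (by simp)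
  filter_upwards [h] with s hs
  have h1 : z s = (z t + (s - t) • z') + (z s - (z t + (s - t) • z')) := by abel
  have h2 : N (z s) ≤ N (z t + (s - t) • z') + N (z s - (z t + (s - t) • z')) := by
    conv_lhs => rw [h1]
    exact map_add_le_add N _ _
  have h3 := hN (z s - (z t + (s - t) • z'))
  simp only [Pi.sub_apply, sub_self, zero_smul, add_zero, sub_zero]
  linarith

/-- A continuous function whose upper right Dini derivative is at most `c` grows at most with
rate `c`. -/
theorem image_le {c : ℝ} (hc : ContinuousOn g (Icc a b))
    (h : ∀ t ∈ Ico a b, UpperDini g t c) {t : ℝ} (ht : t ∈ Icc a b) :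
    g t ≤ g a + c * (t - a) := by
  refine image_le_of_liminf_slope_right_le_deriv_boundary (B := fun t => g a + c * (t - a))
    (B' := fun _ => c) hc (by simp) (by fun_prop) (fun x _ => ?_) (fun x hx r hr => ?_) ht
  · simpa using! (((hasDerivWithinAt_id x (Ici x)).sub_const a).const_mul c).const_add (g a)
  · obtain ⟨r', h1, h2⟩ := exists_between hr
    refine Eventually.frequently ?_
    filter_upwards [h x hx r' h1, self_mem_nhdsWithin] with s hs hxs
    have : 0 < s - x := sub_pos.2 hxs
    rw [slope_def_field, div_lt_iff₀ this]
    nlinarith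

end UpperDini

/-! ## Global solutions of Lipschitz differential equations -/

section ODE

variable {E : Type*} [NormedAddCommGroup E] [NormedSpace ℝ E]

/-- The radial retraction onto the closed ball of radius `ρ` around `e`. -/
noncomputable def radialRetraction (e : E) (ρ : ℝ) (z : E) : E :=
  e + (ρ / max ρ ‖z - e‖) • (z - e)

theorem radialRetraction_mem {e : E} {ρ : ℝ} (hρ : 0 < ρ) (z : E) :
    radialRetraction e ρ z ∈ Metric.closedBall e ρ := by
  have h : 0 < max ρ ‖z - e‖ := lt_max_of_lt_left hρ
  rw [radialRetraction, mem_closedBall_iff_norm, add_sub_cancel_left, norm_smul, Real.norm_eq_abs,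
    abs_of_pos (by positivity), div_mul_eq_mul_div, div_le_iff₀ h]
  gcongr
  exact le_max_right _ _

theorem radialRetraction_of_mem {e : E} {ρ : ℝ} (hρ : 0 < ρ) {z : E}
    (hz : z ∈ Metric.closedBall e ρ) : radialRetraction e ρ z = z := by
  rw [mem_closedBall_iff_norm] at hz
  rw [radialRetraction, max_eq_left hz, div_self hρ.ne', one_smul, add_sub_cancel]

theorem lipschitzWith_radialRetraction (e : E) {ρ : ℝ} (hρ : 0 < ρ) :
    LipschitzWith 2 (radialRetraction e ρ) := by
  refine LipschitzWith.of_dist_le_mul fun x y => ?_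
  rw [dist_eq_norm, dist_eq_norm]
  set M := max ρ ‖x - e‖ with hM
  set N := max ρ ‖y - e‖ with hN
  have hM0 : 0 < M := lt_max_of_lt_left hρ
  have hN0 : 0 < N := lt_max_of_lt_left hρ
  -- Move the point at a fixed scale, then change the scale; each part costs at most `‖x - y‖`,
  -- hence the constant 2.
  have h1 : radialRetraction e ρ x - radialRetraction e ρ y
      = (ρ / M) • (x - y) + (ρ / M - ρ / N) • (y - e) := by
    simp only [radialRetraction, ← hM, ← hN]
    module
  have h2 : ‖(ρ / M) • (x - y)‖ ≤ ‖x - y‖ := by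
    rw [norm_smul, Real.norm_eq_abs, abs_of_pos (by positivity)]
    exact mul_le_of_le_one_left (norm_nonneg _) ((div_le_one hM0).2 (le_max_left _ _))
  have h3 : |N - M| ≤ ‖x - y‖ := by
    calc |N - M| ≤ max |ρ - ρ| |‖y - e‖ - ‖x - e‖| := abs_max_sub_max_le_max _ _ _ _
      _ = |‖y - e‖ - ‖x - e‖| := by simp
      _ ≤ ‖(y - e) - (x - e)‖ := abs_norm_sub_norm_le _ _
      _ = ‖x - y‖ := by rw [sub_sub_sub_cancel_right, norm_sub_rev]
  have h4 : ‖(ρ / M - ρ / N) • (y - e)‖ ≤ ‖x - y‖ := by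
    have : ρ / M - ρ / N = (ρ / M) * ((N - M) / N) := by field_simp
    rw [norm_smul, this, Real.norm_eq_abs, abs_mul,
      abs_of_pos (by positivity : 0 < ρ / M), abs_div, abs_of_pos hN0]
    calc ρ / M * (|N - M| / N) * ‖y - e‖ ≤ 1 * (|N - M| / N) * N := by
          gcongr
          · exact (div_le_one hM0).2 (le_max_left _ _)
          · exact le_max_right _ _
      _ = |N - M| := by field_simp
      _ ≤ _ := h3
  rw [h1]
  calc _ ≤ _ := norm_add_le _ _
    _ ≤ ((2 : NNReal) : ℝ) * ‖x - y‖ := by push_cast; linarith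

/-- A field bounded by `L` cannot leave the ball of radius `L * k` during `[0, k]`, so
Picard–Lindelöf applies on the whole interval; uniqueness glues the solutions for different `k`. -/
theorem exists_isSolutionOn_Ici_of_bounded [CompleteSpace E] {F : E → E} {K : NNReal}
    (hF : LipschitzWith K F) {L : NNReal} (hL : ∀ z, ‖F z‖ ≤ L) (z₀ : E) :
    ∃ z : ℝ → E, z 0 = z₀ ∧ IsSolutionOn F z (Ici 0) := by
  have key : ∀ k : ℕ, ∃ z : ℝ → E, z 0 = z₀ ∧ IsSolutionOn F z (Icc 0 (k : ℝ)) := by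
    intro k
    have hpl : IsPicardLindelof (fun _ => F) (⟨0, by simp⟩ : Icc (0 : ℝ) k) z₀ (L * k) 0 L K :=
      IsPicardLindelof.of_time_independent (fun z _ => hL z) hF.lipschitzOnWith (by simp)
    exact hpl.exists_eq_forall_mem_Icc_hasDerivWithinAt₀
  choose z hz0 hz using key
  have right : ∀ (k : ℕ) (t : ℝ), t ∈ Ico 0 (k : ℝ) →
      HasDerivWithinAt (z k) (F (z k t)) (Ici t) t :=
    fun k t ht => (hz k t (Ico_subset_Icc_self ht)).mono_of_mem_nhdsWithin
      (mem_of_superset (Icc_mem_nhdsGE ht.2) (Icc_subset_Icc_left ht.1))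
  have agree : ∀ j k : ℕ, j ≤ k → EqOn (z j) (z k) (Icc 0 j) := by
    intro j k hjk
    have hjk' : (j : ℝ) ≤ k := by exact_mod_cast hjk
    refine ODE_solution_unique (v := fun _ => F) (K := K) (fun _ => hF)
      (HasDerivWithinAt.continuousOn (hz j)) (right j)
      ((HasDerivWithinAt.continuousOn (hz k)).mono (Icc_subset_Icc_right hjk'))
      (fun t ht => right k t ⟨ht.1, ht.2.trans_le hjk'⟩) ?_
    rw [hz0, hz0]
  have eq : ∀ k : ℕ, ∀ t ∈ Ico (0 : ℝ) k, z (⌊t⌋₊ + 1) t = z k t := by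
    intro k t ht
    refine agree _ k ?_ ⟨ht.1, by push_cast; exact (Nat.lt_floor_add_one t).le⟩
    exact Nat.succ_le_of_lt ((Nat.floor_lt ht.1).2 ht.2)
  -- The index `⌊t⌋₊ + 1` puts `t` strictly below the right endpoint, so a one-sided neighbourhood
  -- of `t` in `[0, ∞)` is covered by one solution.
  refine ⟨fun t => z (⌊t⌋₊ + 1) t, by simp [hz0], fun t ht => ?_⟩
  set k := ⌊t⌋₊ + 1 with hk
  have htk : t < k := by rw [hk]; push_cast; exact Nat.lt_floor_add_one t
  have h1 : Icc (0 : ℝ) k ∈ 𝓝[Ici 0] t := by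
    filter_upwards [self_mem_nhdsWithin, nhdsWithin_le_nhds (Iio_mem_nhds htk)] with s h1 h2
    exact ⟨h1, le_of_lt h2⟩
  refine ((hz k t ⟨ht, htk.le⟩).mono_of_mem_nhdsWithin h1).congr_of_eventuallyEq ?_
    (eq k t ⟨ht, htk⟩)
  filter_upwards [self_mem_nhdsWithin, nhdsWithin_le_nhds (Iio_mem_nhds htk)] with s h1 h2
  exact eq k s ⟨h1, h2⟩

end ODE

/-! ## Lyapunov's direct method with Dini derivatives -/

section Lyapunov

variable {E : Type*} [NormedAddCommGroup E] [NormedSpace ℝ E]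

/-- `U` decreases along the solutions of `ż = F z` in `S` with rate at least `N`. -/
def DecreasesAlong (F : E → E) (S : Set E) (U N : E → ℝ) : Prop :=
  ∀ (z : ℝ → E) (t : ℝ), z t ∈ S → HasDerivWithinAt z (F (z t)) (Ici t) t →
    UpperDini (fun s => U (z s)) t (-N (z t))

theorem IsSolutionOn.hasDerivWithinAt_Ici {F : E → E} {z : ℝ → E} {T t : ℝ}
    (hz : IsSolutionOn F z (Ico 0 T)) (ht : t ∈ Ico 0 T) :
    HasDerivWithinAt z (F (z t)) (Ici t) t :=
  (hz t ht).mono_of_mem_nhdsWithin (mem_of_superset (Ico_mem_nhdsGE ht.2)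
    (Ico_subset_Ico_left ht.1))

theorem IsSolutionOn.continuousOn {F : E → E} {z : ℝ → E} {S : Set ℝ}
    (hz : IsSolutionOn F z S) : ContinuousOn z S :=
  fun t ht => (hz t ht).continuousWithinAt

/-- Along a solution that stays in `S`, the function `U` decreases with any rate below `N`. -/
theorem DecreasesAlong.le_sub {F : E → E} {S : Set E} {U N : E → ℝ}
    (hdec : DecreasesAlong F S U N) (hU : ContinuousOn U S) {z : ℝ → E} {T t ν : ℝ}
    (hz : IsSolutionOn F z (Ico 0 T)) (ht : t ∈ Ico 0 T) (hS : ∀ s ∈ Icc 0 t, z s ∈ S)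
    (hν : ∀ s ∈ Ico 0 t, ν ≤ N (z s)) : U (z t) ≤ U (z 0) - ν * t := by
  have hsub : Icc 0 t ⊆ Ico 0 T := Icc_subset_Ico_right ht.2
  have := UpperDini.image_le (g := fun s => U (z s)) (a := 0) (b := t) (c := -ν)
    (hU.comp (hz.continuousOn.mono hsub) hS)
    (fun s hs => (hdec z s (hS s (Ico_subset_Icc_self hs))
      (hz.hasDerivWithinAt_Ici (hsub (Ico_subset_Icc_self hs)))).mono
        (neg_le_neg (hν s hs))) (right_mem_Icc.2 ht.1)
  simpa [sub_eq_add_neg] using this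

theorem exists_pos_forall_le_of_isCompact {E : Type*} [TopologicalSpace E] {S : Set E}
    (hS : IsCompact S) {U : E → ℝ}
    (hU : ContinuousOn U S) (hpos : ∀ z ∈ S, 0 < U z) : ∃ α > 0, ∀ z ∈ S, α ≤ U z := by
  rcases S.eq_empty_or_nonempty with rfl | hne
  · exact ⟨1, one_pos, by simp⟩
  · obtain ⟨z, hz, hmin⟩ := hS.exists_isMinOn hne hU
    exact ⟨U z, hpos z hz, fun y hy => hmin hy⟩

/-- `U` is at least some `α > 0` on the sphere of radius `ε`, below `α` near `e`, and nonincreasing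
along solutions, so the sphere is never reached. As `δ` is chosen before `F`, it also serves for a
modified field. -/
theorem DecreasesAlong.exists_trapping [ProperSpace E] {e : E} {ρ : ℝ}
    {U N : E → ℝ} (hU : ContinuousOn U (Metric.closedBall e ρ)) (hUe : U e = 0)
    (hUpos : ∀ z ∈ Metric.closedBall e ρ, z ≠ e → 0 < U z)
    (hN : ∀ z ∈ Metric.closedBall e ρ, 0 ≤ N z)
    {ε : ℝ} (hε : 0 < ε) (hερ : ε ≤ ρ) :
    ∃ δ > 0, ∀ F : E → E, DecreasesAlong F (Metric.closedBall e ρ) U N →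
      ∀ (T : ℝ) (z : ℝ → E), IsSolutionOn F z (Ico 0 T) →
      ‖z 0 - e‖ < δ → ∀ t ∈ Ico 0 T, ‖z t - e‖ < ε := by
  have hsphere : Metric.sphere e ε ⊆ Metric.closedBall e ρ :=
    Metric.sphere_subset_closedBall.trans (Metric.closedBall_subset_closedBall hερ)
  obtain ⟨α, hα, hαU⟩ := exists_pos_forall_le_of_isCompact (isCompact_sphere e ε)
    (hU.mono hsphere) fun z hz => hUpos z (hsphere hz) (by
      rintro rfl
      rw [Metric.mem_sphere, dist_self] at hz
      exact hε.ne hz)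
  have hcont : ContinuousAt U e :=
    hU.continuousAt (Metric.closedBall_mem_nhds e (hε.trans_le hερ))
  obtain ⟨δ₀, hδ₀, hδU⟩ := Metric.eventually_nhds_iff.1
    (hcont.eventually_lt_const (show U e < α by rwa [hUe]))
  refine ⟨min δ₀ ε, lt_min hδ₀ hε, fun F hdec T z hz hz0 => ?_⟩
  by_contra! hcon
  obtain ⟨t₁, ht₁, hout⟩ := hcon
  have hsub : Icc 0 t₁ ⊆ Ico 0 T := Icc_subset_Ico_right ht₁.2
  have hzc : ContinuousOn (fun t => ‖z t - e‖) (Icc 0 t₁) :=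
    ((hz.continuousOn.mono hsub).sub continuousOn_const).norm
  have hcomp : IsCompact (Icc 0 t₁ ∩ (fun t => ‖z t - e‖) ⁻¹' Ici ε) :=
    isCompact_Icc.of_isClosed_subset (hzc.preimage_isClosed_of_isClosed isClosed_Icc isClosed_Ici)
      inter_subset_left
  -- The first time at which the distance to `e` reaches `ε`; up to then the solution stays in the
  -- ball where `U` decreases.
  obtain ⟨t, ⟨ht, htε⟩, hmin⟩ := hcomp.exists_isLeast ⟨t₁, right_mem_Icc.2 ht₁.1, hout⟩
  have hbefore : ∀ s ∈ Ico 0 t, ‖z s - e‖ < ε := fun s hs => by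
    by_contra! h
    exact absurd (hmin ⟨⟨hs.1, hs.2.le.trans ht.2⟩, h⟩) (not_le.2 hs.2)
  have hteq : ‖z t - e‖ = ε := by
    refine le_antisymm ?_ htε
    have ht0 : 0 < t := lt_of_le_of_ne ht.1 (by
      rintro rfl
      exact absurd htε (not_le.2 (hz0.trans_le (min_le_right _ _))))
    have htend : Tendsto (fun s => ‖z s - e‖) (𝓝[Ico 0 t] t) (𝓝 ‖z t - e‖) :=
      (hzc t ht).mono (Ico_subset_Icc_self.trans (Icc_subset_Icc_right ht.2))
    have : (𝓝[Ico 0 t] t).NeBot := by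
      rw [nhdsWithin_Ico_eq_nhdsLT ht0]; infer_instance
    exact le_of_tendsto htend (eventually_mem_nhdsWithin.mono fun s hs => (hbefore s hs).le)
  have hin : ∀ s ∈ Icc 0 t, z s ∈ Metric.closedBall e ρ := fun s hs => by
    rw [mem_closedBall_iff_norm]
    rcases hs.2.lt_or_eq with h | rfl
    · exact (hbefore s ⟨hs.1, h⟩).le.trans hερ
    · exact hteq.le.trans hερ
  have h1 := hdec.le_sub hU hz (hsub ht) hin (ν := 0)
    (fun s hs => hN _ (hin s (Ico_subset_Icc_self hs)))
  have h2 := hαU (z t) (by rw [mem_sphere_iff_norm, hteq])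
  have h3 : U (z 0) < α := hδU (by rw [dist_eq_norm]; exact hz0.trans_le (min_le_left _ _))
  linarith

theorem IsSolutionOn.shift {F : E → E} {z : ℝ → E} (hz : IsSolutionOn F z (Ici 0)) {t₀ : ℝ}
    (ht₀ : 0 ≤ t₀) : IsSolutionOn F (fun t => z (t + t₀)) (Ici 0) := by
  intro t ht
  have h1 : HasDerivWithinAt (fun t => t + t₀) 1 (Ici 0) t :=
    (hasDerivWithinAt_id t _).add_const t₀
  have h2 := (hz (t + t₀) (add_nonneg ht ht₀)).scomp t h1
    (fun s hs => add_nonneg hs ht₀)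
  simpa using! h2

/-- Lyapunov's theorem on asymptotic stability, for a Lyapunov function with a strictly negative
upper right Dini derivative along solutions. -/
theorem isAsymptoticallyStable_of_decreasesAlong [ProperSpace E] {F : E → E}
    {e : E} {S : Set E} (hS : S ∈ 𝓝 e) {K : NNReal} (hF : LipschitzOnWith K F S) {U N : E → ℝ}
    (hU : ContinuousOn U S) (hUe : U e = 0) (hUpos : ∀ z ∈ S, z ≠ e → 0 < U z)
    (hN : ContinuousOn N S) (hNe : 0 ≤ N e) (hNpos : ∀ z ∈ S, z ≠ e → 0 < N z)
    (hdec : DecreasesAlong F S U N) : IsAsymptoticallyStable F e := by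
  obtain ⟨ρ, hρ, hρS⟩ := Metric.nhds_basis_closedBall.mem_iff.1 hS
  replace hF := hF.mono hρS
  replace hU := hU.mono hρS
  replace hN := hN.mono hρS
  replace hUpos := fun z hz => hUpos z (hρS hz)
  replace hNpos := fun z hz => hNpos z (hρS hz)
  replace hdec : DecreasesAlong F (Metric.closedBall e ρ) U N := fun z t ht => hdec z t (hρS ht)
  have hN0 : ∀ z ∈ Metric.closedBall e ρ, 0 ≤ N z := fun z hz => by
    rcases eq_or_ne z e with rfl | h
    exacts [hNe, (hNpos z hz h).le]
  have hU0 : ∀ z ∈ Metric.closedBall e ρ, 0 ≤ U z := fun z hz => by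
    rcases eq_or_ne z e with rfl | h
    exacts [hUe.ge, (hUpos z hz h).le]
  have trap := fun {ε : ℝ} (hε : 0 < ε) (hερ : ε ≤ ρ) =>
    DecreasesAlong.exists_trapping hU hUe hUpos hN0 hε hερ
  constructor
  · obtain ⟨δ, hδ, h⟩ := trap hρ le_rfl
    refine ⟨δ, hδ, fun z₀ hz₀ => ?_⟩
    -- This field is bounded and globally Lipschitz. Its solutions starting near `e` are trapped in
    -- the ball, where it coincides with `F`.
    set F' : E → E := F ∘ radialRetraction e ρ with hF'
    have heq : ∀ z ∈ Metric.closedBall e ρ, F' z = F z := fun z hz => by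
      simp only [hF', Function.comp, radialRetraction_of_mem hρ hz]
    have hlip : LipschitzWith (K * 2) F' := by
      rw [← lipschitzOnWith_univ]
      exact hF.comp (lipschitzWith_radialRetraction e hρ).lipschitzOnWith
        (fun z _ => radialRetraction_mem hρ z)
    obtain ⟨L, hL⟩ := (isCompact_closedBall e ρ).exists_bound_of_continuousOn hF.continuousOn
    obtain ⟨z, hz0, hz⟩ := exists_isSolutionOn_Ici_of_bounded hlip (L := L.toNNReal)
      (fun z => (hL _ (radialRetraction_mem hρ z)).trans (Real.le_coe_toNNReal L)) z₀
    have hdec' : DecreasesAlong F' (Metric.closedBall e ρ) U N := fun z t ht hzt =>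
      hdec z t ht (by rwa [← heq _ ht])
    refine ⟨z, hz0, fun t ht => ?_⟩
    have hzt := h F' hdec' (t + 1) z (fun s hs => (hz s hs.1).mono Ico_subset_Ici_self)
      (by rwa [hz0]) t ⟨ht, by linarith⟩
    have := hz t ht
    rwa [heq _ (by rw [mem_closedBall_iff_norm]; exact hzt.le)] at this
  · intro ε hε
    obtain ⟨δ, hδ, h⟩ := trap (lt_min hε hρ) (min_le_right _ _)
    exact ⟨δ, hδ, fun T z hz hz0 t ht => (h F hdec T z hz hz0 t ht).trans_le (min_le_left _ _)⟩
  · obtain ⟨δ, hδ, h⟩ := trap hρ le_rfl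
    refine ⟨δ, hδ, fun z hz hz0 => ?_⟩
    have hIco : ∀ T, IsSolutionOn F z (Ico 0 T) := fun T s hs =>
      (hz s hs.1).mono Ico_subset_Ici_self
    have hin : ∀ t, 0 ≤ t → z t ∈ Metric.closedBall e ρ := fun t ht => by
      rw [mem_closedBall_iff_norm]
      exact (h F hdec (t + 1) z (hIco _) hz0 t ⟨ht, by linarith⟩).le
    rw [Metric.tendsto_atTop]
    intro ε hε
    obtain ⟨δ', hδ', h'⟩ := trap (lt_min hε hρ) (min_le_right _ _)
    -- A solution avoiding the `δ'`-ball forever would stay in a compact annulus with `N ≥ ν > 0`,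
    -- and `U` would become negative by time `(U (z 0) + 1) / ν`.
    obtain ⟨t₀, ht₀, hzt₀⟩ : ∃ t₀ ≥ 0, ‖z t₀ - e‖ < δ' := by
      by_contra! hcon
      have hA : Metric.closedBall e ρ \ Metric.ball e δ' ⊆ Metric.closedBall e ρ := sdiff_subset
      obtain ⟨ν, hν, hνN⟩ := exists_pos_forall_le_of_isCompact
        ((isCompact_closedBall e ρ).diff Metric.isOpen_ball) (hN.mono hA)
        (fun y hy => hNpos y hy.1 (by
          rintro rfl
          exact hy.2 (Metric.mem_ball_self hδ')))
      have hle : ∀ t, 0 ≤ t → U (z t) ≤ U (z 0) - ν * t := fun t ht =>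
        hdec.le_sub hU (hIco (t + 1)) ⟨ht, by linarith⟩ (fun s hs => hin s hs.1)
          (fun s hs => hνN _ ⟨hin s hs.1, by
            rw [mem_ball_iff_norm, not_lt]; exact hcon s hs.1⟩)
      have h0 : 0 ≤ U (z 0) := hU0 _ (hin 0 le_rfl)
      have ht : 0 ≤ (U (z 0) + 1) / ν := by positivity
      have h1 := hle _ ht
      rw [mul_div_cancel₀ _ hν.ne'] at h1
      linarith [hU0 _ (hin _ ht)]
    refine ⟨t₀, fun t ht => ?_⟩
    have h1 := h' F hdec (t - t₀ + 1) (fun s => z (s + t₀))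
      (fun s hs => (hz.shift ht₀ s hs.1).mono Ico_subset_Ici_self) (by simpa using hzt₀)
      (t - t₀) ⟨by linarith, by linarith⟩
    rw [sub_add_cancel] at h1
    rw [dist_eq_norm]
    exact h1.trans_le (min_le_left _ _)

end Lyapunov

/-! ## The consensus seminorm of a digraph with a globally reachable node -/

open Matrix

section Spread

variable {ι : Type*} [Fintype ι]

/-- The largest difference `|v i - v j|` between two coordinates. -/
noncomputable def spread : Seminorm ℝ (ι → ℝ) :=
  (normSeminorm ℝ (ι × ι → ℝ)).comp
    (LinearMap.pi fun p => LinearMap.proj (R := ℝ) (φ := fun _ : ι => ℝ) p.1 - LinearMap.proj p.2)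

theorem abs_sub_le_spread (v : ι → ℝ) (i j : ι) : |v i - v j| ≤ spread v :=
  norm_le_pi_norm (fun p : ι × ι => v p.1 - v p.2) (i, j)

theorem spread_le {v : ι → ℝ} {b : ℝ} (hb : 0 ≤ b) (h : ∀ i j, v i - v j ≤ b) : spread v ≤ b :=
  (pi_norm_le_iff_of_nonneg (x := fun p : ι × ι => v p.1 - v p.2) hb).2
    fun p => abs_le.2 ⟨by linarith [h p.2 p.1], h p.1 p.2⟩

theorem spread_one : spread (1 : ι → ℝ) = 0 :=
  le_antisymm (spread_le le_rfl (by simp)) (apply_nonneg _ _)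

/-- A row-stochastic matrix whose column `r` is bounded below by `γ` contracts the spread by the
factor `1 - γ`. -/
theorem spread_mulVec_le [DecidableEq ι] {B : Matrix ι ι ℝ} (hB : B ∈ rowStochastic ℝ ι) {γ : ℝ}
    {r : ι} (hγ : ∀ i, γ ≤ B i r) (hγ1 : γ ≤ 1) (v : ι → ℝ) :
    spread (B *ᵥ v) ≤ (1 - γ) * spread v := by
  -- Weight `γ` on column `r` pulls every row average below the maximum by `γ * (v i₀ - v r)` and
  -- above the minimum by `γ * (v r - v j₀)`; the sum is `γ` times the spread.
  obtain ⟨i₀, -, hi₀⟩ := Finset.exists_max_image Finset.univ v ⟨r, Finset.mem_univ r⟩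
  obtain ⟨j₀, -, hj₀⟩ := Finset.exists_min_image Finset.univ v ⟨r, Finset.mem_univ r⟩
  refine spread_le (mul_nonneg (sub_nonneg.2 hγ1) (apply_nonneg _ _)) fun i j => ?_
  have hsum := sum_row_of_mem_rowStochastic hB
  have hnn : ∀ i l, 0 ≤ B i l := fun _ _ => nonneg_of_mem_rowStochastic hB
  have h1 : γ * (v i₀ - v r) ≤ v i₀ - (B *ᵥ v) i := by
    have : v i₀ - (B *ᵥ v) i = ∑ l, B i l * (v i₀ - v l) := by
      simp only [mul_sub, Finset.sum_sub_distrib, ← Finset.sum_mul, hsum, one_mul, mulVec,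
        dotProduct]
    rw [this]
    calc γ * (v i₀ - v r) ≤ B i r * (v i₀ - v r) :=
          mul_le_mul_of_nonneg_right (hγ i) (sub_nonneg.2 (hi₀ r (Finset.mem_univ r)))
      _ ≤ _ := Finset.single_le_sum (f := fun l => B i l * (v i₀ - v l))
          (fun l _ => mul_nonneg (hnn i l)
          (sub_nonneg.2 (hi₀ l (Finset.mem_univ l)))) (Finset.mem_univ r)
  have h2 : γ * (v r - v j₀) ≤ (B *ᵥ v) j - v j₀ := by
    have : (B *ᵥ v) j - v j₀ = ∑ l, B j l * (v l - v j₀) := by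
      simp only [mul_sub, Finset.sum_sub_distrib, ← Finset.sum_mul, hsum, one_mul, mulVec,
        dotProduct]
    rw [this]
    calc γ * (v r - v j₀) ≤ B j r * (v r - v j₀) :=
          mul_le_mul_of_nonneg_right (hγ j) (sub_nonneg.2 (hj₀ r (Finset.mem_univ r)))
      _ ≤ _ := Finset.single_le_sum (f := fun l => B j l * (v l - v j₀))
          (fun l _ => mul_nonneg (hnn j l)
          (sub_nonneg.2 (hj₀ l (Finset.mem_univ l)))) (Finset.mem_univ r)
  have h3 : (1 - γ) * (v i₀ - v j₀) ≤ (1 - γ) * spread v :=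
    mul_le_mul_of_nonneg_left ((le_abs_self _).trans (abs_sub_le_spread v i₀ j₀))
      (sub_nonneg.2 hγ1)
  linarith

/-- If a power of a row-stochastic matrix `A` has a positive column, then some seminorm that is
equivalent to the spread is contracted by `A`. -/
theorem exists_seminorm_mulVec_le [DecidableEq ι] {A : Matrix ι ι ℝ} (hA : A ∈ rowStochastic ℝ ι)
    {k : ℕ} (hk : 0 < k) {r : ι} (hr : ∀ i, 0 < (A ^ k) i r) :
    ∃ N : Seminorm ℝ (ι → ℝ), ∃ θ > 0, (∀ v, spread v ≤ N v) ∧ (∀ v, N v ≤ k * spread v) ∧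
      ∀ v, N (A *ᵥ v) ≤ (1 - θ) * N v := by
  have hpow : ∀ j, A ^ j ∈ rowStochastic ℝ ι := fun j => pow_mem hA j
  obtain ⟨i₁, -, hi₁⟩ := Finset.exists_min_image Finset.univ (fun i => (A ^ k) i r)
    ⟨r, Finset.mem_univ r⟩
  set γ := (A ^ k) i₁ r
  have hγ : 0 < γ := hr i₁
  have hk' : (0 : ℝ) < k := by exact_mod_cast hk
  -- Summing the spread over the first `k` iterates telescopes: `N (A v) = N v - spread v + spread
  -- (A ^ k v) ≤ N v - γ * spread v`, and `spread v ≥ N v / k`.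
  set N : Seminorm ℝ (ι → ℝ) := ∑ j ∈ Finset.range k, spread.comp (A ^ j).mulVecLin with hN
  have hNv : ∀ v, N v = ∑ j ∈ Finset.range k, spread ((A ^ j) *ᵥ v) := fun v => by
    change FunLike.coeAddMonoidHom _ _ _ (∑ j ∈ Finset.range k, spread.comp (A ^ j).mulVecLin) v = _
    rw [map_sum, Finset.sum_apply]
    rfl
  have hle : ∀ v, N v ≤ k * spread v := fun v => by
    rw [hNv]
    calc _ ≤ ∑ j ∈ Finset.range k, spread v := Finset.sum_le_sum fun j _ => by
          simpa using spread_mulVec_le (hpow j) (r := r)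
            (fun i => nonneg_of_mem_rowStochastic (hpow j)) zero_le_one v
      _ = _ := by simp
  refine ⟨N, γ / k, by positivity, fun v => ?_, hle, fun v => ?_⟩
  · rw [hNv]
    calc spread v = spread ((A ^ 0) *ᵥ v) := by simp
      _ ≤ _ := Finset.single_le_sum (f := fun j => spread ((A ^ j) *ᵥ v))
        (fun _ _ => apply_nonneg _ _) (Finset.mem_range.2 hk)
  · have h1 : N (A *ᵥ v) + spread v = N v + spread ((A ^ k) *ᵥ v) := by
      have h2 := Finset.sum_range_succ (fun j => spread ((A ^ j) *ᵥ v)) k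
      have h3 := Finset.sum_range_succ' (fun j => spread ((A ^ j) *ᵥ v)) k
      rw [hNv, hNv, ← h2, h3]
      simp [pow_succ]
    have h2 := spread_mulVec_le (hpow k) (fun i => hi₁ i (Finset.mem_univ i))
      (le_one_of_mem_rowStochastic (hpow k)) v
    have h3 : γ / k * N v ≤ γ * spread v := by
      calc γ / k * N v ≤ γ / k * (k * spread v) := by gcongr; exact hle v
        _ = _ := by field_simp
    linarith

end Spread

/-! ### The graph Laplacian and its Euler steps -/

namespace WeightedDigraph

variable {m : ℕ} (G : WeightedDigraph m)

theorem laplacian_mulVec (v : Fin m → ℝ) (i : Fin m) :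
    (G.laplacian *ᵥ v) i = ∑ l, G.a i l * (v i - v l) := by
  have h : ∀ l, G.laplacian i l * v l
      = (if i = l then (∑ l ∈ Finset.univ.erase i, G.a i l + G.a i i) * v i else 0)
        - G.a i l * v l := by
    intro l
    by_cases hil : i = l
    · subst hil; simp [laplacian]; ring
    · simp [laplacian, hil]
  simp only [mulVec, dotProduct, h, Finset.sum_sub_distrib, Finset.sum_ite_eq, Finset.mem_univ,
    if_true, mul_sub, ← Finset.sum_mul, Finset.sum_erase_add _ _ (Finset.mem_univ i)]

theorem laplacian_mulVec_one : G.laplacian *ᵥ 1 = 0 := by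
  ext i
  simp [laplacian_mulVec]

/-- At a node where `v` is minimal, every term `a i l * (v i - v l)` is nonpositive. This is what
provides the invariant average `ζ`. -/
theorem one_notMem_range_laplacian [NeZero m] (v : Fin m → ℝ) : G.laplacian *ᵥ v ≠ 1 := by
  intro h
  obtain ⟨i, -, hi⟩ := Finset.exists_min_image Finset.univ v ⟨0, Finset.mem_univ _⟩
  have h1 : (G.laplacian *ᵥ v) i = 1 := by rw [h]; rfl
  rw [laplacian_mulVec] at h1
  have h2 : ∑ l, G.a i l * (v i - v l) ≤ 0 := Finset.sum_nonpos fun l _ =>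
    mul_nonpos_of_nonneg_of_nonpos (G.nonneg i l) (sub_nonpos.2 (hi l (Finset.mem_univ l)))
  linarith

/-- For a small step size, the Euler step of the consensus dynamics is a row-stochastic matrix
with a positive diagonal, and it has positive entries along the edges. -/
theorem exists_eulerStep : ∃ δ : ℝ, 0 < δ ∧ 1 - δ • G.laplacian ∈ rowStochastic ℝ (Fin m) ∧
    (∀ i, 0 < (1 - δ • G.laplacian) i i) ∧
    ∀ i j, i ≠ j → G.Edge i j → 0 < (1 - δ • G.laplacian) i j := by
  -- The total weight bounds every row sum, so the step `1 / (1 + S)` keeps the diagonal positive.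
  set S := ∑ i, ∑ l, G.a i l with hS
  have hS0 : 0 ≤ S := Finset.sum_nonneg fun i _ => Finset.sum_nonneg fun l _ => G.nonneg i l
  have hle : ∀ i, ∑ l ∈ Finset.univ.erase i, G.a i l ≤ S := fun i =>
    (Finset.sum_le_sum_of_subset_of_nonneg (Finset.erase_subset _ _)
      (fun l _ _ => G.nonneg i l)).trans
    (Finset.single_le_sum (f := fun i => ∑ l, G.a i l)
      (fun i _ => Finset.sum_nonneg fun l _ => G.nonneg i l) (Finset.mem_univ i))
  have hδ : 0 < (1 + S)⁻¹ := by positivity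
  have hdiag : ∀ i, 0 < (1 - (1 + S)⁻¹ • G.laplacian) i i := fun i => by
    have : (1 + S)⁻¹ * ∑ l ∈ Finset.univ.erase i, G.a i l < 1 := by
      rw [inv_mul_lt_iff₀ (by positivity)]
      linarith [hle i]
    simpa [laplacian] using this
  have hoff : ∀ i j, i ≠ j →
      (1 - (1 + S)⁻¹ • G.laplacian) i j = (1 + S)⁻¹ * G.a i j := fun i j hij => by
    simp [laplacian, hij]
  refine ⟨(1 + S)⁻¹, hδ, mem_rowStochastic.2 ⟨fun i j => ?_, ?_⟩, hdiag, fun i j hij he => ?_⟩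
  · rcases eq_or_ne i j with rfl | hij
    · exact (hdiag i).le
    · rw [hoff i j hij]
      exact mul_nonneg hδ.le (G.nonneg i j)
  · rw [sub_mulVec, one_mulVec, smul_mulVec, laplacian_mulVec_one, smul_zero, sub_zero]
  · rw [hoff i j hij]
    exact mul_pos hδ he

variable {G}

/-- A path of length `k` from `i` to `r` makes `(A ^ k) i r` positive, and the positive diagonal
allows waiting at a node, so one large exponent works for all `i`. -/
theorem exists_pow_pos_column {A : Matrix (Fin m) (Fin m) ℝ} (hA : A ∈ rowStochastic ℝ (Fin m))
    (hdiag : ∀ i, 0 < A i i) (hedge : ∀ i j, i ≠ j → G.Edge i j → 0 < A i j) {r : Fin m}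
    (hr : G.GloballyReachable r) : ∃ k > 0, ∀ i, 0 < (A ^ k) i r := by
  have step : ∀ i j k, 0 < A i j → 0 < (A ^ k) j r → 0 < (A ^ (k + 1)) i r := by
    intro i j k h1 h2
    rw [pow_succ', mul_apply]
    refine Finset.sum_pos' (fun l _ => mul_nonneg (nonneg_of_mem_rowStochastic hA)
      (nonneg_of_mem_rowStochastic (pow_mem hA k))) ⟨j, Finset.mem_univ j, mul_pos h1 h2⟩
  have mono : ∀ i k k', k ≤ k' → 0 < (A ^ k) i r → 0 < (A ^ k') i r := by
    intro i k k' hkk' h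
    induction k', hkk' using Nat.le_induction with
    | base => exact h
    | succ n _ ih => exact step i i n (hdiag i) ih
  have edge' : ∀ i j, G.Edge i j → 0 < A i j := fun i j h => by
    rcases eq_or_ne i j with rfl | hij
    exacts [hdiag i, hedge i j hij h]
  have each : ∀ i, ∃ k, 0 < (A ^ k) i r := by
    intro i
    rcases eq_or_ne i r with rfl | hir
    · exact ⟨0, by simp⟩
    · refine (hr i hir).head_induction_on (motive := fun i _ => ∃ k, 0 < (A ^ k) i r) ?_ ?_
      · intro a h
        exact ⟨1, by simpa using edge' a r h⟩
      · rintro a c hac - ⟨k, hk⟩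
        exact ⟨k + 1, step a c k (edge' a c hac) hk⟩
  choose k hk using each
  exact ⟨∑ i, k i + 1, Nat.succ_pos _, fun i => mono i (k i) _
    ((Finset.single_le_sum (fun _ _ => Nat.zero_le _) (Finset.mem_univ i)).trans
      (Nat.le_succ _)) (hk i)⟩

/-- A seminorm, equivalent to the spread, that decays exponentially along `v̇ = -L v`. -/
theorem exists_seminorm_sub_smul_laplacian_le (hG : ∃ i, G.GloballyReachable i) :
    ∃ N : Seminorm ℝ (Fin m → ℝ), ∃ c > 0, ∃ s₀ > 0, ∃ C > 0, (∀ v, spread v ≤ N v) ∧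
      (∀ v, N v ≤ C * spread v) ∧
      ∀ s ∈ Icc 0 s₀, ∀ v, N (v - s • G.laplacian *ᵥ v) ≤ (1 - c * s) * N v := by
  obtain ⟨r, hr⟩ := hG
  obtain ⟨δ, hδ, hA, hdiag, hedge⟩ := G.exists_eulerStep
  obtain ⟨k, hk, hcol⟩ := exists_pow_pos_column hA hdiag hedge hr
  obtain ⟨N, θ, hθ, h1, h2, h3⟩ := exists_seminorm_mulVec_le hA hk hcol
  refine ⟨N, θ / δ, by positivity, δ, hδ, k, by exact_mod_cast hk, h1, h2, fun s hs v => ?_⟩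
  have hs1 : s / δ ≤ 1 := (div_le_one hδ).2 hs.2
  have hs0 : 0 ≤ s / δ := div_nonneg hs.1 hδ.le
  -- A shorter Euler step is a convex combination of `v` and the step of size `δ`.
  have heq : v - s • G.laplacian *ᵥ v
      = (1 - s / δ) • v + (s / δ) • ((1 - δ • G.laplacian) *ᵥ v) := by
    rw [sub_mulVec, one_mulVec, smul_mulVec, smul_sub, smul_smul, div_mul_cancel₀ _ hδ.ne']
    module
  calc N (v - s • G.laplacian *ᵥ v)
      ≤ N ((1 - s / δ) • v) + N ((s / δ) • ((1 - δ • G.laplacian) *ᵥ v)) := by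
        rw [heq]; exact map_add_le_add _ _ _
    _ = (1 - s / δ) * N v + s / δ * N ((1 - δ • G.laplacian) *ᵥ v) := by
        rw [map_smul_eq_mul, map_smul_eq_mul, Real.norm_of_nonneg hs0,
          Real.norm_of_nonneg (sub_nonneg.2 hs1)]
    _ ≤ (1 - s / δ) * N v + s / δ * ((1 - θ) * N v) := by gcongr; exact h3 v
    _ = _ := by field_simp; ring

end WeightedDigraph

/-- The vector `𝟏`. -/
noncomputable def ones (m : ℕ) : Vec m := WithLp.toLp 2 1

@[simp] theorem ones_apply {m : ℕ} (i : Fin m) : ones m i = 1 := rfl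

theorem norm_le_sqrt_mul {m : ℕ} {v : Vec m} {b : ℝ} (hb : 0 ≤ b) (h : ∀ i, |v i| ≤ b) :
    ‖v‖ ≤ √m * b := by
  rw [EuclideanSpace.norm_eq, Real.sqrt_le_left (by positivity), mul_pow, Real.sq_sqrt (by simp)]
  calc ∑ i, ‖v i‖ ^ 2 ≤ ∑ _i : Fin m, b ^ 2 := Finset.sum_le_sum fun i _ => by
        gcongr; exact h i
    _ = _ := by simp

theorem abs_apply_le_norm {m : ℕ} (v : Vec m) (i : Fin m) : |v i| ≤ ‖v‖ := PiLp.norm_apply_le v i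

/-- The data of the consensus dynamics `v̇ = -L v`: the weighted average `ζ` is invariant, and the
seminorm `N`, which measures the distance to consensus, decays exponentially. -/
structure ConsensusData {m : ℕ} (G : WeightedDigraph m) (N : Seminorm ℝ (Vec m))
    (ζ : Vec m →L[ℝ] ℝ) (c s₀ C : ℝ) : Prop where
  c_pos : 0 < c
  s₀_pos : 0 < s₀
  C_pos : 0 < C
  average_ones : ζ (ones m) = 1
  average_laplacian : ∀ v, ζ (Matrix.toEuclideanLin G.laplacian v) = 0
  laplacian_ones : Matrix.toEuclideanLin G.laplacian (ones m) = 0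
  seminorm_ones : N (ones m) = 0
  seminorm_le : ∀ v, N v ≤ C * ‖v‖
  norm_sub_le : ∀ v, ‖v - ζ v • ones m‖ ≤ C * N v
  decay : ∀ s ∈ Icc 0 s₀, ∀ v,
    N (v - s • Matrix.toEuclideanLin G.laplacian v) ≤ (1 - c * s) * N v

theorem WeightedDigraph.exists_consensusData {m : ℕ} {G : WeightedDigraph m}
    (hG : ∃ i, G.GloballyReachable i) : ∃ N ζ c s₀ C, ConsensusData G N ζ c s₀ C := by
  have : NeZero m := ⟨by rintro rfl; exact hG.choose.elim0⟩
  obtain ⟨N, c, hc, s₀, hs₀, C, hC, h1, h2, h3⟩ := exists_seminorm_sub_smul_laplacian_le hG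
  have hones : ones m ∉ LinearMap.range (Matrix.toEuclideanLin G.laplacian) := by
    rintro ⟨v, hv⟩
    exact G.one_notMem_range_laplacian (WithLp.ofLp v) (congrArg WithLp.ofLp hv)
  -- Normalized at `𝟏`, a functional that kills the range of the Laplacian but not `𝟏` is the
  -- invariant average.
  obtain ⟨ζ₀, hζ₀, hker⟩ := Submodule.exists_le_ker_of_notMem hones
  set ζ : Vec m →L[ℝ] ℝ := (ζ₀ (ones m))⁻¹ • LinearMap.toContinuousLinearMap ζ₀ with hζ
  have hζ1 : ζ (ones m) = 1 := by simp [hζ, hζ₀]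
  have hN1 : ∀ v : Vec m, N (WithLp.ofLp v) ≤ 2 * C * ‖v‖ := fun v => by
    have : spread (WithLp.ofLp v) ≤ 2 * ‖v‖ := spread_le (by positivity) fun i j => by
      have := abs_le.1 (abs_apply_le_norm v i)
      have := abs_le.1 (abs_apply_le_norm v j)
      linarith
    nlinarith [h2 (WithLp.ofLp v)]
  have hsub : ∀ v : Vec m, ‖v - ζ v • ones m‖ ≤ (√m * (‖ζ‖ * √m)) * N (WithLp.ofLp v) := by
    intro v
    have hpt : ∀ i, ‖v i • ones m - v‖ ≤ √m * N (WithLp.ofLp v) := fun i =>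
      norm_le_sqrt_mul (apply_nonneg _ _) fun j => by
        simpa using (abs_sub_le_spread (WithLp.ofLp v) i j).trans (h1 _)
    rw [mul_assoc]
    refine norm_le_sqrt_mul (by positivity) fun i => ?_
    -- Each coordinate of the deviation is `ζ` of a vector of coordinate differences, which the
    -- spread controls.
    have heq : (v - ζ v • ones m) i = ζ (v i • ones m - v) := by simp [hζ1]
    rw [heq, mul_assoc]
    exact (ζ.le_opNorm _).trans (mul_le_mul_of_nonneg_left (hpt i) (norm_nonneg _))
  refine ⟨N.comp (WithLp.linearEquiv 2 ℝ (Fin m → ℝ)).toLinearMap, ζ, c, s₀,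
    2 * C + √m * (‖ζ‖ * √m), hc, hs₀, by positivity, hζ1, fun v => ?_, ?_, ?_, fun v => ?_,
    fun v => ?_, fun s hs v => ?_⟩
  · have : ζ₀ (Matrix.toEuclideanLin G.laplacian v) = 0 :=
      hker (LinearMap.mem_range_self _ v)
    rw [hζ]
    simp [this]
  · exact congrArg (WithLp.toLp 2) G.laplacian_mulVec_one
  · exact le_antisymm ((h2 _).trans_eq (by
      rw [show ((WithLp.linearEquiv 2 ℝ (Fin m → ℝ)).toLinearMap (ones m)) = 1 from rfl,
        spread_one, mul_zero])) (apply_nonneg _ _)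
  · exact (hN1 v).trans (mul_le_mul_of_nonneg_right (le_add_of_nonneg_right (by positivity))
      (norm_nonneg v))
  · exact (hsub v).trans (mul_le_mul_of_nonneg_right (le_add_of_nonneg_left (by positivity))
      (apply_nonneg _ _))
  · exact h3 s hs (WithLp.ofLp v)

/-! ## Convex conjugates of barrier costs -/

theorem isOpen_openInterval (lo hi : EReal) : IsOpen (openInterval lo hi) :=
  (isOpen_Ioi.preimage continuous_coe_real_ereal).inter
    (isOpen_Iio.preimage continuous_coe_real_ereal)

theorem ordConnected_openInterval (lo hi : EReal) : (openInterval lo hi).OrdConnected :=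
  ⟨fun _ hx _ hy _ hz => ⟨hx.1.trans_le (EReal.coe_le_coe_iff.2 hz.1),
    (EReal.coe_le_coe_iff.2 hz.2).trans_lt hy.2⟩⟩

/-- Guarantees that the barrier condition at `hi` is not vacuous. -/
theorem comap_coe_nhdsLT_neBot {lo hi : EReal} (h : lo < hi) :
    (comap (fun ξ : ℝ => (ξ : EReal)) (𝓝[<] hi)).NeBot := by
  refine comap_neBot fun t ht => ?_
  obtain ⟨l, hl, hlt⟩ := (mem_nhdsLT_iff_exists_Ioo_subset' h).1 ht
  obtain ⟨x, h1, h2⟩ := EReal.lt_iff_exists_real_btwn.1 hl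
  exact ⟨x, hlt ⟨h1, h2⟩⟩

theorem comap_coe_nhdsGT_neBot {lo hi : EReal} (h : lo < hi) :
    (comap (fun ξ : ℝ => (ξ : EReal)) (𝓝[>] lo)).NeBot := by
  refine comap_neBot fun t ht => ?_
  obtain ⟨l, hl, hlt⟩ := (mem_nhdsGT_iff_exists_Ioo_subset' h).1 ht
  obtain ⟨x, h1, h2⟩ := EReal.lt_iff_exists_real_btwn.1 hl
  exact ⟨x, hlt ⟨h1, h2⟩⟩

namespace CostAssumption

variable {lo hi : EReal} {J : ℝ → ℝ}

theorem nonempty (hJ : CostAssumption lo hi J) : (openInterval lo hi).Nonempty := by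
  obtain ⟨x, h1, h2⟩ := EReal.lt_iff_exists_real_btwn.1 hJ.lo_lt_hi
  exact ⟨x, h1, h2⟩

theorem hasDerivAt (hJ : CostAssumption lo hi J) {x : ℝ} (hx : x ∈ openInterval lo hi) :
    HasDerivAt J (deriv J x) x :=
  ((hJ.contDiff.contDiffAt ((isOpen_openInterval lo hi).mem_nhds hx)).differentiableAt
    one_ne_zero).hasDerivAt

theorem continuousOn_deriv (hJ : CostAssumption lo hi J) :
    ContinuousOn (deriv J) (openInterval lo hi) :=
  hJ.contDiff.continuousOn_deriv_of_isOpen (isOpen_openInterval lo hi) le_rfl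

/-- The mean value theorem on the domain of the cost. -/
theorem exists_sub_eq_deriv_mul (hJ : CostAssumption lo hi J) {x y : ℝ}
    (hx : x ∈ openInterval lo hi) (hy : y ∈ openInterval lo hi) (hxy : x ≠ y) :
    ∃ z ∈ openInterval lo hi, 0 < (z - x) * (y - x) ∧ J y - J x = deriv J z * (y - x) := by
  have aux : ∀ a ∈ openInterval lo hi, ∀ b ∈ openInterval lo hi, a < b →
      ∃ z ∈ openInterval lo hi, z ∈ Ioo a b ∧ J b - J a = deriv J z * (b - a) := by
    intro a ha b hb hab
    have hsub := (ordConnected_openInterval lo hi).out ha hb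
    obtain ⟨z, hz, hzd⟩ := exists_hasDerivAt_eq_slope J (deriv J) hab
      (fun t ht => (hJ.hasDerivAt (hsub ht)).continuousAt.continuousWithinAt)
      (fun t ht => hJ.hasDerivAt (hsub (Ioo_subset_Icc_self ht)))
    refine ⟨z, hsub (Ioo_subset_Icc_self hz), hz, ?_⟩
    rw [hzd, div_mul_cancel₀ _ (sub_pos.2 hab).ne']
  rcases hxy.lt_or_gt with h | h
  · obtain ⟨z, hz, hzI, hd⟩ := aux x hx y hy h
    exact ⟨z, hz, mul_pos (sub_pos.2 hzI.1) (sub_pos.2 h), hd⟩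
  · obtain ⟨z, hz, hzI, hd⟩ := aux y hy x hx h
    exact ⟨z, hz, mul_pos_of_neg_of_neg (sub_neg.2 hzI.2) (sub_neg.2 h), by linarith⟩

/-- The gradient inequality of a strictly convex function. -/
theorem add_deriv_mul_lt (hJ : CostAssumption lo hi J) {x y : ℝ}
    (hx : x ∈ openInterval lo hi) (hy : y ∈ openInterval lo hi) (hxy : x ≠ y) :
    J x + deriv J x * (y - x) < J y := by
  obtain ⟨z, hz, hzx, hd⟩ := hJ.exists_sub_eq_deriv_mul hx hy hxy
  obtain ⟨μ, hμ, hconv⟩ := hJ.stronglyConvex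
  have hne : z - x ≠ 0 := fun h => by simp [h] at hzx
  have h1 : 0 < (deriv J z - deriv J x) * (z - x) :=
    (mul_pos hμ (pow_pos (abs_pos.2 hne) 2)).trans_le (hconv z hz x hx)
  have h2 : 0 < (deriv J z - deriv J x) * (y - x) := by
    -- The factors `z - x` and `y - x` have the same sign.
    have : 0 < ((deriv J z - deriv J x) * (y - x)) * (z - x) ^ 2 := by nlinarith [mul_pos h1 hzx]
    exact pos_of_mul_pos_left this (sq_nonneg _)
  nlinarith

theorem add_deriv_mul_le (hJ : CostAssumption lo hi J) {x y : ℝ}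
    (hx : x ∈ openInterval lo hi) (hy : y ∈ openInterval lo hi) :
    J x + deriv J x * (y - x) ≤ J y := by
  rcases eq_or_ne x y with rfl | h
  · simp
  · exact (hJ.add_deriv_mul_lt hx hy h).le

/-- If `J' < p` everywhere, strong convexity bounds `ξ - ξ₀` by `(p - J' ξ₀) / μ`, so `J` is bounded
to the right of `ξ₀`, against the barrier at `hi`. This covers finite and infinite endpoints alike.
-/
theorem exists_le_deriv (hJ : CostAssumption lo hi J) (p : ℝ) :
    ∃ ξ ∈ openInterval lo hi, p ≤ deriv J ξ := by
  by_contra! hcon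
  obtain ⟨μ, hμ, hconv⟩ := hJ.stronglyConvex
  obtain ⟨ξ₀, hξ₀⟩ := hJ.nonempty
  have := comap_coe_nhdsLT_neBot hJ.lo_lt_hi
  have h1 := hJ.barrier_hi.eventually_gt_atTop (J ξ₀ + |p| * ((p - deriv J ξ₀) / μ))
  have h2 : ∀ᶠ ξ : ℝ in comap (fun ξ : ℝ => (ξ : EReal)) (𝓝[<] hi), (ξ : EReal) ∈ Ioo ↑ξ₀ hi :=
    tendsto_comap.eventually (Ioo_mem_nhdsLT hξ₀.2)
  obtain ⟨ξ, h3, h4, h5⟩ := (h1.and h2).exists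
  have hξ : ξ ∈ openInterval lo hi := ⟨hξ₀.1.trans h4, h5⟩
  have hpos : 0 < ξ - ξ₀ := sub_pos.2 (EReal.coe_lt_coe_iff.1 h4)
  have h6 := hconv ξ hξ ξ₀ hξ₀
  rw [sq_abs] at h6
  have h7 : ξ - ξ₀ ≤ (p - deriv J ξ₀) / μ := by
    rw [le_div_iff₀ hμ]
    have : μ * (ξ - ξ₀) ≤ deriv J ξ - deriv J ξ₀ := le_of_mul_le_mul_right (by linarith) hpos
    linarith [hcon ξ hξ]
  have h8 := hJ.add_deriv_mul_le hξ hξ₀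
  have h9 : deriv J ξ * (ξ - ξ₀) ≤ |p| * ((p - deriv J ξ₀) / μ) :=
    calc deriv J ξ * (ξ - ξ₀) ≤ |p| * (ξ - ξ₀) :=
          mul_le_mul_of_nonneg_right ((hcon ξ hξ).le.trans (le_abs_self p)) hpos.le
      _ ≤ _ := mul_le_mul_of_nonneg_left h7 (abs_nonneg p)
  linarith

theorem exists_deriv_le (hJ : CostAssumption lo hi J) (p : ℝ) :
    ∃ ξ ∈ openInterval lo hi, deriv J ξ ≤ p := by
  by_contra! hcon
  obtain ⟨μ, hμ, hconv⟩ := hJ.stronglyConvex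
  obtain ⟨ξ₀, hξ₀⟩ := hJ.nonempty
  have := comap_coe_nhdsGT_neBot hJ.lo_lt_hi
  have h1 := hJ.barrier_lo.eventually_gt_atTop (J ξ₀ + |p| * ((deriv J ξ₀ - p) / μ))
  have h2 : ∀ᶠ ξ : ℝ in comap (fun ξ : ℝ => (ξ : EReal)) (𝓝[>] lo), (ξ : EReal) ∈ Ioo lo ↑ξ₀ :=
    tendsto_comap.eventually (Ioo_mem_nhdsGT hξ₀.1)
  obtain ⟨ξ, h3, h4, h5⟩ := (h1.and h2).exists
  have hξ : ξ ∈ openInterval lo hi := ⟨h4, h5.trans hξ₀.2⟩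
  have hpos : 0 < ξ₀ - ξ := sub_pos.2 (EReal.coe_lt_coe_iff.1 h5)
  have h6 := hconv ξ hξ ξ₀ hξ₀
  rw [sq_abs] at h6
  have h7 : ξ₀ - ξ ≤ (deriv J ξ₀ - p) / μ := by
    rw [le_div_iff₀ hμ]
    have : μ * (ξ₀ - ξ) ≤ deriv J ξ₀ - deriv J ξ := le_of_mul_le_mul_right (by linarith) hpos
    linarith [hcon ξ hξ]
  have h8 := hJ.add_deriv_mul_le hξ hξ₀
  have h9 : -deriv J ξ * (ξ₀ - ξ) ≤ |p| * ((deriv J ξ₀ - p) / μ) :=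
    calc -deriv J ξ * (ξ₀ - ξ) ≤ |p| * (ξ₀ - ξ) :=
          mul_le_mul_of_nonneg_right ((neg_lt_neg (hcon ξ hξ)).le.trans (neg_le_abs p)) hpos.le
      _ ≤ _ := mul_le_mul_of_nonneg_left h7 (abs_nonneg p)
  linarith

theorem exists_deriv_eq (hJ : CostAssumption lo hi J) (p : ℝ) :
    ∃ ξ ∈ openInterval lo hi, deriv J ξ = p := by
  obtain ⟨a, ha, hap⟩ := hJ.exists_deriv_le p
  obtain ⟨b, hb, hpb⟩ := hJ.exists_le_deriv p
  exact (ordConnected_openInterval lo hi).isPreconnected.intermediate_value ha hb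
    hJ.continuousOn_deriv ⟨hap, hpb⟩

end CostAssumption

/-- The function `ψ` is the inverse of the marginal cost `J'`, and the derivative of the
conjugate. -/
structure IsInverseMarginal (lo hi : EReal) (J ψ : ℝ → ℝ) (K : NNReal) : Prop where
  lipschitz : LipschitzWith K ψ
  strictMono : StrictMono ψ
  mem : ∀ p, ψ p ∈ openInterval lo hi
  deriv_eq : ∀ p, deriv J (ψ p) = p
  apply_deriv : ∀ ξ ∈ openInterval lo hi, ψ (deriv J ξ) = ξ
  isGreatest : ∀ p, IsGreatest (conjValues lo hi J p) (p * ψ p - J (ψ p))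
  hasDerivAt_conj : ∀ p, HasDerivAt (conj lo hi J) (ψ p) p

/-- `J'` maps onto `ℝ`, and strong monotonicity makes its inverse `ψ` Lipschitz with constant `1 /
μ`. By the gradient inequality `ψ p` attains the supremum defining the conjugate at `p`. -/
theorem CostAssumption.exists_isInverseMarginal {lo hi : EReal} {J : ℝ → ℝ}
    (hJ : CostAssumption lo hi J) : ∃ ψ K, IsInverseMarginal lo hi J ψ K := by
  obtain ⟨μ, hμ, hconv⟩ := hJ.stronglyConvex
  choose ψ hmem hd using hJ.exists_deriv_eq
  have hmono : ∀ p q, μ * (ψ p - ψ q) ^ 2 ≤ (p - q) * (ψ p - ψ q) := fun p q => by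
    have := hconv _ (hmem p) _ (hmem q)
    rwa [hd, hd, sq_abs] at this
  have habs : ∀ p q, μ * |ψ p - ψ q| ≤ |p - q| := fun p q => by
    rcases eq_or_ne (ψ p - ψ q) 0 with h | h
    · rw [h, abs_zero, mul_zero]
      exact abs_nonneg _
    · refine le_of_mul_le_mul_right ?_ (abs_pos.2 h)
      rw [mul_assoc, ← sq, sq_abs, ← abs_mul]
      exact (hmono p q).trans (le_abs_self _)
  have hstrict : StrictMono ψ := fun p q hpq => by
    rcases lt_or_ge (ψ p) (ψ q) with h | h
    · exact h
    · rcases h.eq_or_lt with h | h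
      · exact absurd (by rw [← hd p, ← hd q, h]) hpq.ne
      · nlinarith [hmono p q, mul_pos (sub_pos.2 hpq) (sub_pos.2 h), sq_nonneg (ψ p - ψ q)]
  have happly : ∀ ξ ∈ openInterval lo hi, ψ (deriv J ξ) = ξ := fun ξ hξ => by
    have := hconv _ (hmem (deriv J ξ)) _ hξ
    rw [hd, sub_self, zero_mul, sq_abs] at this
    have h0 : (ψ (deriv J ξ) - ξ) ^ 2 ≤ 0 := by
      by_contra! h
      nlinarith [mul_pos hμ h]
    exact sub_eq_zero.1 (pow_eq_zero_iff two_ne_zero |>.1 (le_antisymm h0 (sq_nonneg _)))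
  have hgreat : ∀ p, IsGreatest (conjValues lo hi J p) (p * ψ p - J (ψ p)) := fun p => by
    refine ⟨⟨ψ p, hmem p, rfl⟩, ?_⟩
    rintro _ ⟨ξ, hξ, rfl⟩
    have := hJ.add_deriv_mul_le (hmem p) hξ
    rw [hd] at this
    dsimp only
    linarith
  have hconj : ∀ p, conj lo hi J p = p * ψ p - J (ψ p) := fun p => (hgreat p).csSup_eq
  have hsub : ∀ p q, conj lo hi J p + (q - p) * ψ p ≤ conj lo hi J q := fun p q => by
    have := (hgreat q).2 ⟨ψ p, hmem p, rfl⟩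
    rw [hconj, hconj]
    dsimp only at this
    linarith
  refine ⟨ψ, (1 / μ).toNNReal, LipschitzWith.of_dist_le_mul fun p q => ?_, hstrict, hmem, hd,
    happly, hgreat, fun p => ?_⟩
  · rw [Real.coe_toNNReal _ (by positivity), Real.dist_eq, Real.dist_eq, one_div,
      ← div_eq_inv_mul, le_div_iff₀ hμ, mul_comm]
    exact habs p q
  · rw [hasDerivAt_iff_isLittleO]
    refine Asymptotics.IsBigO.trans_isLittleO (g := fun q => ‖q - p‖ ^ 2) ?_
      (Asymptotics.isLittleO_pow_sub_sub p one_lt_two)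
    refine Asymptotics.IsBigO.of_bound (1 / μ) (Eventually.of_forall fun q => ?_)
    -- The subgradient inequalities at `p` and at `q` place the first-order remainder between 0 and
    -- `(q - p) * (ψ q - ψ p)`, which is quadratic in `q - p`.
    have h1 := hsub p q
    have h2 := hsub q p
    have h3 : (q - p) * (ψ q - ψ p) ≤ |q - p| * (|q - p| / μ) := by
      calc (q - p) * (ψ q - ψ p) ≤ |q - p| * |ψ q - ψ p| := by
            rw [← abs_mul]; exact le_abs_self _
        _ ≤ _ := by
          gcongr
          rw [le_div_iff₀ hμ, mul_comm]
          exact habs q p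
    rw [smul_eq_mul, Real.norm_of_nonneg (by linarith), Real.norm_of_nonneg (by positivity),
      Real.norm_eq_abs]
    calc _ ≤ (q - p) * (ψ q - ψ p) := by linarith
      _ ≤ _ := h3
      _ = _ := by ring

/-! ## The resource-allocation problem -/

theorem lt_of_hasDerivAt_of_strictMono {g R : ℝ → ℝ} (hg : ∀ s, HasDerivAt g (R s) s)
    (hR : StrictMono R) {a s : ℝ} (ha : R a = 0) (hs : s ≠ a) : g a < g s := by
  have hc : Continuous g := continuous_iff_continuousAt.2 fun s => (hg s).continuousAt
  rcases hs.lt_or_gt with h | h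
  · refine strictAntiOn_of_deriv_neg (convex_Iic a) hc.continuousOn (fun x hx => ?_)
      h.le self_mem_Iic h
    rw [interior_Iic] at hx
    rw [(hg x).deriv, ← ha]
    exact hR hx
  · refine strictMonoOn_of_deriv_pos (convex_Ici a) hc.continuousOn (fun x hx => ?_)
      self_mem_Ici h.le h
    rw [interior_Ici] at hx
    rw [(hg x).deriv, ← ha]
    exact hR hx

section Allocation

variable {m : ℕ} {lo hi : Fin m → EReal} {J ψ : Fin m → ℝ → ℝ} {K : Fin m → NNReal} {d : ℝ}

theorem gradConj_apply (hψ : ∀ i, IsInverseMarginal (lo i) (hi i) (J i) (ψ i) (K i)) (η : Vec m)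
    (i : Fin m) : gradConj lo hi J η i = ψ i (η i) :=
  ((hψ i).hasDerivAt_conj (η i)).deriv

theorem exists_lipschitzWith_gradConj
    (hψ : ∀ i, IsInverseMarginal (lo i) (hi i) (J i) (ψ i) (K i)) :
    ∃ L, LipschitzWith L (gradConj lo hi J) := by
  refine ⟨NNReal.sqrt m * ∑ i, K i, LipschitzWith.of_dist_le_mul fun x y => ?_⟩
  rw [dist_eq_norm, dist_eq_norm, NNReal.coe_mul, Real.coe_sqrt, NNReal.coe_natCast,
    mul_assoc]
  refine norm_le_sqrt_mul (by positivity) fun i => ?_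
  rw [PiLp.sub_apply, gradConj_apply hψ, gradConj_apply hψ]
  calc |ψ i (x i) - ψ i (y i)| ≤ K i * |x i - y i| := (hψ i).lipschitz.dist_le_mul _ _
    _ ≤ (∑ i, K i : NNReal) * ‖x - y‖ := by
      gcongr
      · exact Finset.single_le_sum (fun _ _ => zero_le) (Finset.mem_univ i)
      · exact abs_apply_le_norm (x - y) i

/-- The imbalance `∑ i, ψ i s - d` at the common marginal price `s`. -/
noncomputable def imbalance (ψ : Fin m → ℝ → ℝ) (d s : ℝ) : ℝ := ∑ i, ψ i s - d

/-- The negative of the dual function of the resource-allocation problem. -/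
noncomputable def negDual (lo hi : Fin m → EReal) (J : Fin m → ℝ → ℝ) (d s : ℝ) : ℝ :=
  ∑ i, conj (lo i) (hi i) (J i) s - d * s

theorem hasDerivAt_negDual (hψ : ∀ i, IsInverseMarginal (lo i) (hi i) (J i) (ψ i) (K i)) (s : ℝ) :
    HasDerivAt (negDual lo hi J d) (imbalance ψ d s) s := by
  have h1 := HasDerivAt.fun_sum (u := Finset.univ) fun i _ => (hψ i).hasDerivAt_conj s
  simpa [negDual, imbalance] using! h1.sub ((hasDerivAt_id s).const_mul d)

theorem continuous_imbalance (hψ : ∀ i, IsInverseMarginal (lo i) (hi i) (J i) (ψ i) (K i)) :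
    Continuous (imbalance ψ d) :=
  (continuous_finsetSum _ fun i _ => (hψ i).lipschitz.continuous).sub continuous_const

theorem strictMono_imbalance [NeZero m]
    (hψ : ∀ i, IsInverseMarginal (lo i) (hi i) (J i) (ψ i) (K i)) :
    StrictMono (imbalance ψ d) := fun _ _ h =>
  sub_lt_sub_right (Finset.sum_lt_sum_of_nonempty ⟨0, Finset.mem_univ _⟩
    fun i _ => (hψ i).strictMono h) d

/-- For a feasible `u`, the smallest marginal cost used as common price allocates too little and the
largest too much; the balancing price lies between. -/
theorem exists_imbalance_eq_zero [NeZero m]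
    (hψ : ∀ i, IsInverseMarginal (lo i) (hi i) (J i) (ψ i) (K i))
    (hfeas : ∃ u, IsFeasible lo hi d u) : ∃ s, imbalance ψ d s = 0 := by
  obtain ⟨u, hu, hsum⟩ := hfeas
  have hval : ∀ i, ψ i (deriv (J i) (u i)) = u i := fun i => (hψ i).apply_deriv _ (hu i)
  have huniv : (Finset.univ : Finset (Fin m)).Nonempty := ⟨0, Finset.mem_univ _⟩
  obtain ⟨i, -, hi⟩ := Finset.exists_min_image Finset.univ (fun i => deriv (J i) (u i)) huniv
  obtain ⟨j, -, hj⟩ := Finset.exists_max_image Finset.univ (fun i => deriv (J i) (u i)) huniv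
  have h1 : imbalance ψ d (deriv (J i) (u i)) ≤ 0 := by
    rw [hsum]
    refine sub_le_sub_right (Finset.sum_le_sum fun l hl => ?_) d
    rw [← hval l]
    exact (hψ l).strictMono.monotone (hi l hl)
  have h2 : 0 ≤ imbalance ψ d (deriv (J j) (u j)) := by
    rw [hsum]
    refine sub_le_sub_right (Finset.sum_le_sum fun l hl => ?_) d
    rw [← hval l]
    exact (hψ l).strictMono.monotone (hj l hl)
  exact mem_range_of_exists_le_of_exists_ge (continuous_imbalance hψ) ⟨_, h1⟩ ⟨_, h2⟩

theorem sum_gradConj_smul_ones (hψ : ∀ i, IsInverseMarginal (lo i) (hi i) (J i) (ψ i) (K i))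
    (s : ℝ) : ∑ i, gradConj lo hi J (s • ones m) i - d = imbalance ψ d s := by
  simp [gradConj_apply hψ, imbalance]

/-- At a common marginal price with zero imbalance, the allocation is the unique optimizer. -/
theorem isOptimizer_gradConj (hJ : ∀ i, CostAssumption (lo i) (hi i) (J i))
    (hψ : ∀ i, IsInverseMarginal (lo i) (hi i) (J i) (ψ i) (K i)) {s : ℝ}
    (hs : imbalance ψ d s = 0) :
    IsOptimizer lo hi J d (gradConj lo hi J (s • ones m)) ∧
      ∀ v, IsOptimizer lo hi J d v → v = gradConj lo hi J (s • ones m) := by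
  set u := gradConj lo hi J (s • ones m) with hu
  have hui : ∀ i, u i = ψ i s := fun i => by simp [hu, gradConj_apply hψ]
  have humem : ∀ i, u i ∈ openInterval (lo i) (hi i) := fun i => by
    rw [hui]; exact (hψ i).mem s
  have hderiv : ∀ i, deriv (J i) (u i) = s := fun i => by rw [hui]; exact (hψ i).deriv_eq s
  have hfeas : IsFeasible lo hi d u := ⟨humem, by rw [hu, sum_gradConj_smul_ones hψ, hs]⟩
  -- All marginal costs equal `s`, so the first-order terms cancel on the feasible set; the gradient
  -- inequality then gives optimality, and its strict form uniqueness.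
  have hzero : ∀ v, IsFeasible lo hi d v →
      ∑ i, J i (u i) = ∑ i, (J i (u i) + deriv (J i) (u i) * (v i - u i)) := fun v hv => by
    have h1 := hfeas.2
    have h2 := hv.2
    have h3 : ∑ i, v i = ∑ i, u i := by linarith
    simp_rw [hderiv, Finset.sum_add_distrib, ← Finset.mul_sum, Finset.sum_sub_distrib, h3,
      sub_self, mul_zero, add_zero]
  refine ⟨⟨hfeas, fun v hv => ?_⟩, fun v hv => ?_⟩
  · rw [hzero v hv]
    exact Finset.sum_le_sum fun i _ => (hJ i).add_deriv_mul_le (humem i) (hv.1 i)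
  · by_contra hne
    obtain ⟨i, hi⟩ : ∃ i, u i ≠ v i := by
      by_contra! h
      exact hne (by ext i; exact (h i).symm)
    refine absurd (hv.2 u hfeas) (not_le.2 ?_)
    rw [hzero v hv.1]
    exact Finset.sum_lt_sum (fun i _ => (hJ i).add_deriv_mul_le (humem i) (hv.1.1 i))
      ⟨i, Finset.mem_univ i, (hJ i).add_deriv_mul_lt (humem i) (hv.1.1 i) hi⟩

end Allocation

/-! ## Equilibria of the closed loop -/

section Equilibrium

variable {n m q : ℕ} {f : Vec n → Vec m → Vec q → Vec n} {h : Vec n → Vec m → Vec q → Vec m}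
  {X : Set (Vec n)} {I : Set (Vec m × Vec q)} {π : Vec m × Vec q → Vec n} {β : ℝ} {d : Vec q → ℝ}

theorem PowerSystemAssumption.eq_of_equilibrium (hps : PowerSystemAssumption f h X I π β d)
    {x : Vec n} {u : Vec m} {w : Vec q} (hx : x ∈ X) (hu : (u, w) ∈ I) (hf : f x u w = 0) :
    x = π (u, w) := by
  obtain ⟨V, c₁, c₂, c₃, c₄, -, -, hc₃, -, -, hV⟩ := hps.lyapunov
  obtain ⟨-, -, -, h1, -⟩ := hV x hx u w hu
  rw [hf, map_zero] at h1
  have h2 : ‖x - π (u, w)‖ ^ 2 ≤ 0 := by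
    by_contra! h
    nlinarith [mul_pos hc₃ h]
  exact sub_eq_zero.1 (norm_eq_zero.1 (pow_eq_zero_iff two_ne_zero |>.1
    (le_antisymm h2 (sq_nonneg _))))

theorem PowerSystemAssumption.output_equilibrium (hps : PowerSystemAssumption f h X I π β d)
    {u : Vec m} {w : Vec q} (hu : (u, w) ∈ I) :
    h (π (u, w)) u w = ((∑ j, u j - d w) / β) • ones m := by
  ext i
  rw [hps.steadyState u w hu]
  simp [div_eq_inv_mul]

variable {G : WeightedDigraph m} {N : Seminorm ℝ (Vec m)} {ζ : Vec m →L[ℝ] ℝ} {c s₀ C : ℝ}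
  {lo hi : Fin m → EReal} {J ψ : Fin m → ℝ → ℝ} {K : Fin m → NNReal} {w : Vec q}

theorem closedLoop_snd (x : Vec n) (η : Vec m) (τ : ℝ) :
    (closedLoop f h G lo hi J w τ (x, η)).2 = τ⁻¹ • (-h x (gradConj lo hi J η) w
      - Matrix.toEuclideanLin G.laplacian η) := rfl

theorem isEquilibrium_smul_ones (hps : PowerSystemAssumption f h X I π β d)
    (hC : ConsensusData G N ζ c s₀ C)
    (hψ : ∀ i, IsInverseMarginal (lo i) (hi i) (J i) (ψ i) (K i)) {s : ℝ}
    (hs : imbalance ψ (d w) s = 0) (hI : (gradConj lo hi J (s • ones m), w) ∈ I) (τ : ℝ) :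
    IsEquilibrium f h X I G lo hi J w τ
      (π (gradConj lo hi J (s • ones m), w), s • ones m) := by
  refine ⟨hps.mapsTo_π hI, hI, Prod.ext (hps.equilibrium_π _ _ hI) ?_⟩
  rw [closedLoop_snd, hps.output_equilibrium hI, sum_gradConj_smul_ones hψ, hs, map_smul,
    hC.laplacian_ones]
  simp

theorem IsEquilibrium.eq [NeZero m] (hps : PowerSystemAssumption f h X I π β d)
    (hC : ConsensusData G N ζ c s₀ C)
    (hψ : ∀ i, IsInverseMarginal (lo i) (hi i) (J i) (ψ i) (K i)) {s : ℝ}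
    (hs : imbalance ψ (d w) s = 0) {τ : ℝ} (hτ : 0 < τ) {p : Vec n × Vec m}
    (hp : IsEquilibrium f h X I G lo hi J w τ p) :
    p = (π (gradConj lo hi J (s • ones m), w), s • ones m) := by
  obtain ⟨x, η⟩ := p
  obtain ⟨hx, hI, hzero⟩ := hp
  dsimp only at hx hI
  have hxπ := hps.eq_of_equilibrium hx hI (congrArg Prod.fst hzero)
  have h2 : τ⁻¹ • (-h x (gradConj lo hi J η) w - Matrix.toEuclideanLin G.laplacian η) = 0 :=
    congrArg Prod.snd hzero
  rw [smul_eq_zero, or_iff_right (inv_ne_zero hτ.ne'), hxπ, hps.output_equilibrium hI] at h2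
  set r := (∑ j, gradConj lo hi J η j - d w) / β with hr
  have hr0 : r = 0 := by
    have := congrArg ζ h2
    simpa only [map_sub, map_neg, map_smul, hC.average_ones, hC.average_laplacian, smul_eq_mul,
      mul_one, sub_zero, map_zero, neg_eq_zero] using! this
  rw [hr0, zero_smul, neg_zero, zero_sub, neg_eq_zero] at h2
  -- Here `L η = 0`, so an Euler step fixes `η` while shrinking `N η`.
  have hN : N η = 0 := by
    have := hC.decay s₀ ⟨hC.s₀_pos.le, le_rfl⟩ η
    rw [h2, smul_zero, sub_zero] at this
    have h3 := mul_pos hC.c_pos hC.s₀_pos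
    nlinarith [apply_nonneg N η]
  have hη : η = ζ η • ones m := by
    have := hC.norm_sub_le η
    rw [hN, mul_zero] at this
    exact sub_eq_zero.1 (norm_le_zero_iff.1 this)
  have hζ : ζ η = s := by
    refine (strictMono_imbalance hψ (d := d w)).injective ?_
    rw [hs, ← sum_gradConj_smul_ones hψ, ← hη]
    rw [hr, div_eq_zero_iff, or_iff_left hps.β_pos.ne'] at hr0
    exact hr0
  rw [hζ] at hη
  rw [hxπ, ← hη]

end Equilibrium

/-! ## Stability of the closed loop -/

/-- Links the joint derivative, needed for the chain rule, to the partial derivatives in which the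
bounds on `V` are stated. -/
theorem exists_fderiv_prod {E F : Type*} [NormedAddCommGroup E] [NormedSpace ℝ E]
    [NormedAddCommGroup F] [NormedSpace ℝ F] {Φ : E → F → ℝ} {x : E} {u : F}
    (h : DifferentiableAt ℝ (fun p : E × F => Φ p.1 p.2) (x, u)) :
    ∃ D : E × F →L[ℝ] ℝ, HasFDerivAt (fun p : E × F => Φ p.1 p.2) D (x, u) ∧
      (∀ v, D (v, 0) = fderiv ℝ (fun x' => Φ x' u) x v) ∧
      D ∘L ContinuousLinearMap.inr ℝ E F = fderiv ℝ (fun u' => Φ x u') u := by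
  have h₁ : HasFDerivAt (fun x' => Φ x' u) _ x :=
    HasFDerivAt.comp (g := fun p : E × F => Φ p.1 p.2) (f := fun x' => (x', u)) x
      h.hasFDerivAt
      (hasFDerivAt_prodMk_left x u)
  have h₂ : HasFDerivAt (fun u' => Φ x u') _ u :=
    HasFDerivAt.comp (g := fun p : E × F => Φ p.1 p.2) (f := fun u' => (x, u')) u
      h.hasFDerivAt
      (hasFDerivAt_prodMk_right x u)
  exact ⟨_, h.hasFDerivAt, fun v => by rw [h₁.fderiv]; rfl, h₂.fderiv.symm⟩

/-- Negative definiteness of the composite rate, for a small gain `ε`. -/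
theorem composite_rate_le {c c₃ β A B κ ε y R E : ℝ} (hβ : 0 < β) (hc : 0 < c) (hκ : 0 < κ)
    (hε : 0 < ε) (hκc : β * A ^ 2 ≤ κ * c)
    (hεc : ε * (β * (A + B) ^ 2 + (2 * κ * A + B) ^ 2 / (2 * κ * c) + B) ≤ c₃ / 2) :
    -c₃ * y ^ 2 + ε * (B * y * (R + E + y)) + ε * (-R ^ 2 / β + A * R * (E + y))
      + κ * (2 * E * (ε * (-c * E + A * y)))
      ≤ -(c₃ / 2 * y ^ 2 + ε / (2 * β) * R ^ 2 + ε * κ * c / 2 * E ^ 2) := by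
  have young : ∀ k a p r : ℝ, 0 < k → a * p * r ≤ k * p ^ 2 + a ^ 2 / (4 * k) * r ^ 2 := by
    intro k a p r hk
    have : k * p ^ 2 + a ^ 2 / (4 * k) * r ^ 2 - a * p * r = k * (p - a / (2 * k) * r) ^ 2 := by
      field_simp
      ring
    have := mul_nonneg hk.le (sq_nonneg (p - a / (2 * k) * r))
    linarith
  -- Budget: the two `R` cross terms use half of `R ^ 2 / β`; of `2 * κ * c * E ^ 2`, at most `κ *
  -- c` goes to `R * E` and `κ * c / 2` to `E * y`. The resulting `y ^ 2` terms are covered by the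
  -- smallness of `ε`.
  have h1 := young (1 / (4 * β)) A R E (by positivity)
  have h2 := young (1 / (4 * β)) (A + B) R y (by positivity)
  have h3 := young (κ * c / 2) (2 * κ * A + B) E y (by positivity)
  have e1 : A ^ 2 / (4 * (1 / (4 * β))) = β * A ^ 2 := by field_simp
  have e2 : (A + B) ^ 2 / (4 * (1 / (4 * β))) = β * (A + B) ^ 2 := by field_simp
  have e3 : (2 * κ * A + B) ^ 2 / (4 * (κ * c / 2)) = (2 * κ * A + B) ^ 2 / (2 * κ * c) := by
    congr 1
    ring
  rw [e1] at h1
  rw [e2] at h2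
  rw [e3] at h3
  have h4 := mul_le_mul_of_nonneg_right hκc (sq_nonneg E)
  have h5 := mul_le_mul_of_nonneg_right hεc (sq_nonneg y)
  have h6 : ε * (B * y * (R + E + y) + (-R ^ 2 / β + A * R * (E + y))
      + 2 * κ * E * (-c * E + A * y)) ≤
      ε * ((β * (A + B) ^ 2 + (2 * κ * A + B) ^ 2 / (2 * κ * c) + B) * y ^ 2
        - 1 / (2 * β) * R ^ 2 - κ * c / 2 * E ^ 2) := by
    refine mul_le_mul_of_nonneg_left ?_ hε.le
    have e4 : -R ^ 2 / β = -(1 / (2 * β) * R ^ 2) - 2 * (1 / (4 * β) * R ^ 2) := by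
      field_simp
      ring
    rw [e4]
    linarith
  have e5 : ε / (2 * β) * R ^ 2 = ε * (1 / (2 * β) * R ^ 2) := by ring
  rw [e5]
  linarith

section Stability

variable {n m q : ℕ} {f : Vec n → Vec m → Vec q → Vec n} {h : Vec n → Vec m → Vec q → Vec m}
  {X : Set (Vec n)} {I : Set (Vec m × Vec q)} {π : Vec m × Vec q → Vec n} {β : ℝ} {d : Vec q → ℝ}
  {G : WeightedDigraph m} {N : Seminorm ℝ (Vec m)} {ζ : Vec m →L[ℝ] ℝ} {c s₀ C : ℝ}
  {lo hi : Fin m → EReal} {J ψ : Fin m → ℝ → ℝ} {K : Fin m → NNReal} {w : Vec q}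

/-- The closed-loop states at which the power system model is valid. -/
def operatingDomain (X : Set (Vec n)) (I : Set (Vec m × Vec q)) (lo hi : Fin m → EReal)
    (J : Fin m → ℝ → ℝ) (w : Vec q) : Set (Vec n × Vec m) :=
  {z | z.1 ∈ X ∧ (gradConj lo hi J z.2, w) ∈ I}

theorem isOpen_operatingDomain (hX : IsOpen X) (hI : IsOpen I)
    (hφ : Continuous (gradConj lo hi J)) : IsOpen (operatingDomain X I lo hi J w) :=
  (hX.preimage continuous_fst).inter (hI.preimage (by fun_prop))

theorem exists_lipschitzOnWith_closedLoop (hps : PowerSystemAssumption f h X I π β d)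
    {L : NNReal} (hφ : LipschitzWith L (gradConj lo hi J)) (τ : ℝ) :
    ∃ M, LipschitzOnWith M (closedLoop f h G lo hi J w τ) (operatingDomain X I lo hi J w) := by
  obtain ⟨Kf, hKf⟩ := hps.lipschitz_f
  obtain ⟨Kh, hKh⟩ := hps.lipschitz_h
  have hg : LipschitzWith _ fun z : Vec n × Vec m => (z.1, (gradConj lo hi J z.2, w)) :=
    LipschitzWith.prod_fst.prodMk ((hφ.comp LipschitzWith.prod_snd).prodMk (LipschitzWith.const w))
  have hmaps : MapsTo (fun z : Vec n × Vec m => (z.1, (gradConj lo hi J z.2, w)))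
      (operatingDomain X I lo hi J w) (X ×ˢ I) := fun z hz => hz
  have hlap := (LinearMap.toContinuousLinearMap (Matrix.toEuclideanLin G.laplacian)).lipschitz.comp
    (LipschitzWith.prod_snd (α := Vec n) (β := Vec m))
  exact ⟨_, (hKf.comp hg.lipschitzOnWith hmaps).prodMk
    ((τ⁻¹ • ContinuousLinearMap.id ℝ (Vec m)).lipschitz.comp_lipschitzOnWith
      ((hKh.comp hg.lipschitzOnWith hmaps).neg.sub hlap.lipschitzOnWith))⟩

theorem ConsensusData.continuous_seminorm (hC : ConsensusData G N ζ c s₀ C) : Continuous N := by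
  refine (LipschitzWith.of_dist_le_mul (K := C.toNNReal) fun x y => ?_).continuous
  rw [Real.coe_toNNReal _ hC.C_pos.le, Real.dist_eq, dist_eq_norm]
  exact (abs_sub_map_le_sub N x y).trans (hC.seminorm_le _)

/-- Bounds for the controller dynamics in terms of the plant error `‖x - π(u, w)‖`, the imbalance
at the average price, and the distance to consensus. -/
theorem exists_controller_bounds (hps : PowerSystemAssumption f h X I π β d)
    (hC : ConsensusData G N ζ c s₀ C)
    (hψ : ∀ i, IsInverseMarginal (lo i) (hi i) (J i) (ψ i) (K i)) :
    ∃ A ≥ 0, ∀ τ > 0, ∀ (x : Vec n) (η : Vec m), (x, η) ∈ operatingDomain X I lo hi J w →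
      let y := ‖x - π (gradConj lo hi J η, w)‖
      let R := imbalance ψ (d w) (ζ η)
      let η' := (closedLoop f h G lo hi J w τ (x, η)).2
      ‖η'‖ ≤ τ⁻¹ * (A * (|R| + N η + y)) ∧
      R * ζ η' ≤ τ⁻¹ * (-|R| ^ 2 / β + A * |R| * (N η + y)) ∧
      ∀ s ∈ Icc 0 (s₀ * τ), N (η + s • η') ≤ N η + τ⁻¹ * (-c * N η + A * y) * s := by
  obtain ⟨L, hL⟩ := exists_lipschitzWith_gradConj hψ
  obtain ⟨Kh, hKh⟩ := hps.lipschitz_h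
  have hβ := hps.β_pos
  have hCpos := hC.C_pos
  set lap := LinearMap.toContinuousLinearMap (Matrix.toEuclideanLin G.laplacian) with hlap
  set Cr : ℝ := m * (L * C) with hCr
  have hCr0 : 0 ≤ Cr := by positivity
  set A₁ : ℝ := ‖ones m‖ / β * (1 + Cr) + Kh + ‖lap‖ * C with hA₁
  set A₂ : ℝ := Cr / β + ‖ζ‖ * Kh with hA₂
  set A₃ : ℝ := C * Kh with hA₃
  have hA₁0 : 0 ≤ A₁ := by positivity
  have hA₂0 : 0 ≤ A₂ := by positivity
  have hA₃0 : 0 ≤ A₃ := by positivity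
  refine ⟨A₁ + A₂ + A₃, by positivity, fun τ hτ x η hz => ?_⟩
  intro y R η'
  obtain ⟨hx, hI⟩ := hz
  dsimp only at hx hI
  set u := gradConj lo hi J η with hu
  set r := ∑ j, u j - d w with hr
  -- The transient part of the output; it vanishes at the plant equilibrium, so the Lipschitz bound
  -- on `h` controls it by `y`.
  set p := h x u w - (r / β) • ones m with hp
  have hτ' : 0 < τ⁻¹ := inv_pos.2 hτ
  have hy0 : 0 ≤ y := norm_nonneg _
  have hN0 : 0 ≤ N η := apply_nonneg _ _
  have hpy : ‖p‖ ≤ Kh * y := by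
    have h1 := hKh.dist_le_mul (x, (u, w)) ⟨hx, hI⟩ (π (u, w), (u, w)) ⟨hps.mapsTo_π hI, hI⟩
    dsimp only at h1
    rw [hps.output_equilibrium hI, dist_eq_norm, Prod.dist_eq, dist_self,
      max_eq_left dist_nonneg, dist_eq_norm] at h1
    exact h1
  have hη' : η' = τ⁻¹ • (-((r / β) • ones m + p) - lap η) := by
    have : (r / β) • ones m + p = h x u w := by rw [hp]; abel
    rw [this]
    rfl
  -- Replacing `η` by its consensus part `ζ η • 𝟏` changes the total input by a multiple of the
  -- disagreement.
  have hrR : |r - R| ≤ Cr * N η := by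
    have h1 : r - R = ∑ i, (u - gradConj lo hi J (ζ η • ones m)) i := by
      have : R = ∑ i, gradConj lo hi J (ζ η • ones m) i - d w :=
        (sum_gradConj_smul_ones hψ _).symm
      simp only [this, hr, PiLp.sub_apply, Finset.sum_sub_distrib]
      ring
    rw [h1]
    calc _ ≤ ∑ i, |(u - gradConj lo hi J (ζ η • ones m)) i| := Finset.abs_sum_le_sum_abs _ _
      _ ≤ ∑ _i : Fin m, ‖u - gradConj lo hi J (ζ η • ones m)‖ :=
        Finset.sum_le_sum fun i _ => abs_apply_le_norm _ i
      _ = m * ‖u - gradConj lo hi J (ζ η • ones m)‖ := by simp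
      _ ≤ m * (L * (C * N η)) := by
        gcongr
        exact (hL.norm_sub_le _ _).trans
          (mul_le_mul_of_nonneg_left (hC.norm_sub_le η) L.coe_nonneg)
      _ = _ := by rw [hCr]; ring
  have hlapη : ‖lap η‖ ≤ ‖lap‖ * C * N η := by
    have h1 : lap η = lap (η - ζ η • ones m) := by
      have : lap (ones m) = 0 := hC.laplacian_ones
      rw [map_sub, map_smul, this, smul_zero, sub_zero]
    rw [h1, mul_assoc]
    exact (lap.le_opNorm _).trans (mul_le_mul_of_nonneg_left (hC.norm_sub_le η) (norm_nonneg _))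
  have hr_abs : |r| ≤ |R| + Cr * N η := by
    have := abs_sub_abs_le_abs_sub r R
    linarith
  have hR0 := abs_nonneg R
  refine ⟨?_, ?_, fun s hs => ?_⟩
  · rw [hη', norm_smul, Real.norm_of_nonneg hτ'.le]
    refine mul_le_mul_of_nonneg_left ?_ hτ'.le
    have h1 : ‖(r / β) • ones m‖ ≤ ‖ones m‖ / β * (|R| + Cr * N η) := by
      rw [norm_smul, Real.norm_eq_abs, abs_div, abs_of_pos hβ]
      calc |r| / β * ‖ones m‖ = ‖ones m‖ / β * |r| := by ring
        _ ≤ _ := mul_le_mul_of_nonneg_left hr_abs (by positivity)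
    have h2 : ‖-((r / β) • ones m + p) - lap η‖ ≤ ‖(r / β) • ones m‖ + ‖p‖ + ‖lap η‖ := by
      refine (norm_sub_le _ _).trans ?_
      rw [norm_neg]
      gcongr
      exact norm_add_le _ _
    have hb : 0 ≤ ‖ones m‖ / β := by positivity
    calc _ ≤ ‖ones m‖ / β * (|R| + Cr * N η) + Kh * y + ‖lap‖ * C * N η := by linarith
      _ ≤ ‖ones m‖ / β * ((1 + Cr) * (|R| + N η + y)) + Kh * (|R| + N η + y)
          + ‖lap‖ * C * (|R| + N η + y) := by
        gcongr
        · nlinarith [mul_nonneg hCr0 hR0, mul_nonneg hCr0 hy0]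
        · linarith
        · linarith
      _ = A₁ * (|R| + N η + y) := by rw [hA₁]; ring
      _ ≤ _ := by gcongr; linarith
  · have h1 : ζ η' = τ⁻¹ * (-(r / β) - ζ p) := by
      have : ζ (lap η) = 0 := hC.average_laplacian η
      rw [hη', map_smul, map_sub, map_neg, map_add, map_smul, hC.average_ones, this, smul_eq_mul,
        smul_eq_mul]
      ring
    have h2 : |ζ p| ≤ ‖ζ‖ * Kh * y := by
      rw [mul_assoc]
      exact (ζ.le_opNorm p).trans (mul_le_mul_of_nonneg_left hpy (norm_nonneg _))
    rw [h1, mul_left_comm]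
    refine mul_le_mul_of_nonneg_left ?_ hτ'.le
    have h3 : R * (-(r / β) - ζ p) = -|R| ^ 2 / β + (R * (R - r) / β + R * -ζ p) := by
      rw [sq_abs]; ring
    have h4 : R * (R - r) ≤ |R| * (Cr * N η) := by
      refine (le_abs_self _).trans ?_
      rw [abs_mul, abs_sub_comm]
      exact mul_le_mul_of_nonneg_left hrR hR0
    have h5 : R * -ζ p ≤ |R| * (‖ζ‖ * Kh * y) := by
      refine (le_abs_self _).trans ?_
      rw [abs_mul, abs_neg]
      exact mul_le_mul_of_nonneg_left h2 hR0
    rw [h3]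
    refine add_le_add_right ?_ _
    calc _ ≤ |R| * (Cr * N η) / β + |R| * (‖ζ‖ * Kh * y) := by gcongr
      _ = Cr / β * (|R| * N η) + ‖ζ‖ * Kh * (|R| * y) := by ring
      _ ≤ Cr / β * (|R| * (N η + y)) + ‖ζ‖ * Kh * (|R| * (N η + y)) := by
        gcongr
        · linarith
        · linarith
      _ = A₂ * |R| * (N η + y) := by rw [hA₂]; ring
      _ ≤ _ := by gcongr; linarith
  · have hsτ : s * τ⁻¹ ∈ Icc 0 s₀ := by
      refine ⟨mul_nonneg hs.1 hτ'.le, ?_⟩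
      rw [← div_eq_mul_inv, div_le_iff₀ hτ]
      exact hs.2
    -- A consensus Euler step, a multiple of `𝟏` that `N` does not see, and the transient.
    have h1 : η + s • η' = (η - (s * τ⁻¹) • lap η)
        + ((-(s * τ⁻¹ * (r / β))) • ones m + (-(s * τ⁻¹)) • p) := by
      rw [hη']
      module
    have h2 : N ((-(s * τ⁻¹ * (r / β))) • ones m + (-(s * τ⁻¹)) • p) ≤ s * τ⁻¹ * (A₃ * y) := by
      refine (map_add_le_add N _ _).trans ?_
      rw [map_smul_eq_mul, map_smul_eq_mul, hC.seminorm_ones, mul_zero, zero_add, norm_neg,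
        Real.norm_of_nonneg hsτ.1]
      refine mul_le_mul_of_nonneg_left ((hC.seminorm_le p).trans ?_) hsτ.1
      rw [hA₃, mul_assoc]
      exact mul_le_mul_of_nonneg_left hpy hCpos.le
    have h3 : s * τ⁻¹ * (A₃ * y) ≤ s * τ⁻¹ * ((A₁ + A₂ + A₃) * y) := by
      refine mul_le_mul_of_nonneg_left ?_ hsτ.1
      gcongr
      linarith
    calc N (η + s • η') ≤ N (η - (s * τ⁻¹) • lap η) + s * τ⁻¹ * (A₃ * y) := by
          rw [h1]
          exact (map_add_le_add N _ _).trans (by gcongr)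
      _ ≤ (1 - c * (s * τ⁻¹)) * N η + s * τ⁻¹ * ((A₁ + A₂ + A₃) * y) :=
          add_le_add (hC.decay _ hsτ η) h3
      _ = _ := by ring

/-- The composite Lyapunov function of the closed loop. -/
noncomputable def compositeLyapunov (V : Vec n → Vec m → Vec q → ℝ) (N : Seminorm ℝ (Vec m))
    (ζ : Vec m →L[ℝ] ℝ) (lo hi : Fin m → EReal) (J : Fin m → ℝ → ℝ) (w : Vec q) (δ σ κ : ℝ)
    (z : Vec n × Vec m) : ℝ :=
  V z.1 (gradConj lo hi J z.2) w
    + (negDual lo hi J δ (ζ z.2) - negDual lo hi J δ σ) + κ * N z.2 ^ 2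

/-- The decay rate of the composite Lyapunov function. -/
noncomputable def compositeRate (π : Vec m × Vec q → Vec n) (N : Seminorm ℝ (Vec m))
    (ζ : Vec m →L[ℝ] ℝ) (lo hi : Fin m → EReal) (J ψ : Fin m → ℝ → ℝ) (w : Vec q)
    (δ a₁ a₂ a₃ : ℝ) (z : Vec n × Vec m) : ℝ :=
  a₁ * ‖z.1 - π (gradConj lo hi J z.2, w)‖ ^ 2 + a₂ * |imbalance ψ δ (ζ z.2)| ^ 2
    + a₃ * N z.2 ^ 2

/-- For a large time constant, the optimal equilibrium is asymptotically stable. -/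
theorem exists_isAsymptoticallyStable [NeZero m] (hps : PowerSystemAssumption f h X I π β d)
    (hC : ConsensusData G N ζ c s₀ C)
    (hψ : ∀ i, IsInverseMarginal (lo i) (hi i) (J i) (ψ i) (K i)) {σ : ℝ}
    (hσ : imbalance ψ (d w) σ = 0) (hI : (gradConj lo hi J (σ • ones m), w) ∈ I) :
    ∃ τstar > 0, ∀ τ ≥ τstar, IsAsymptoticallyStable (closedLoop f h G lo hi J w τ)
      (π (gradConj lo hi J (σ • ones m), w), σ • ones m) := by
  obtain ⟨L, hL⟩ := exists_lipschitzWith_gradConj hψ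
  obtain ⟨V, c₁, c₂, c₃, c₄, hc₁, hc₂, hc₃, hc₄, hVdiff, hV⟩ := hps.lyapunov
  obtain ⟨A, hA, hbounds⟩ := exists_controller_bounds (w := w) hps hC hψ
  have hβ := hps.β_pos
  have hc := hC.c_pos
  have hCpos := hC.C_pos
  -- `B` bounds the effect on `V` of the drifting input. `κ` ensures `β * A ^ 2 ≤ κ * c`, and the
  -- threshold on `τ` ensures `ε * D₀ ≤ c₃ / 2`; the added 1's keep `κ` and the threshold positive.
  set B : ℝ := c₄ * L * A with hB
  set κ : ℝ := β * A ^ 2 / c + 1 with hκ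
  have hκ0 : 0 < κ := by positivity
  set D₀ : ℝ := β * (A + B) ^ 2 + (2 * κ * A + B) ^ 2 / (2 * κ * c) + B with hD₀
  have hD₀0 : 0 ≤ D₀ := by positivity
  refine ⟨2 * D₀ / c₃ + 1, by positivity, fun τ hτ => ?_⟩
  have hτ0 : 0 < τ := lt_of_lt_of_le (by positivity) hτ
  set ε := τ⁻¹ with hε
  have hε0 : 0 < ε := inv_pos.2 hτ0
  have hεc : ε * D₀ ≤ c₃ / 2 := by
    rw [hε, inv_mul_le_iff₀ hτ0]
    calc D₀ = 2 * D₀ / c₃ * (c₃ / 2) := by field_simp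
      _ ≤ τ * (c₃ / 2) := by gcongr; linarith
  set φ := gradConj lo hi J with hφ
  set u₀ := φ (σ • ones m) with hu₀
  set S := operatingDomain X I lo hi J w with hS
  have hSopen : IsOpen S := isOpen_operatingDomain hps.isOpen_X hps.isOpen_I hL.continuous
  obtain ⟨M, hM⟩ := exists_lipschitzOnWith_closedLoop (G := G) (w := w) hps hL τ
  set U := compositeLyapunov V N ζ lo hi J w (d w) σ κ with hU
  set Q := compositeRate π N ζ lo hi J ψ w (d w) (c₃ / 2) (ε / (2 * β)) (ε * κ * c / 2) with hQ
  have hζe : ζ (σ • ones m) = σ := by rw [map_smul, hC.average_ones, smul_eq_mul, mul_one]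
  have hNe : N (σ • ones m) = 0 := by rw [map_smul_eq_mul, hC.seminorm_ones, mul_zero]
  have hdual := hasDerivAt_negDual (d := d w) hψ
  have hdual_cont : Continuous (negDual lo hi J (d w)) :=
    continuous_iff_continuousAt.2 fun s => (hdual s).continuousAt
  have hN_cont := hC.continuous_seminorm
  have hmapsI : MapsTo (fun z : Vec n × Vec m => (φ z.2, w)) S I := fun z hz => hz.2
  have hπ_cont : ContinuousOn (fun z : Vec n × Vec m => π (φ z.2, w)) S :=
    hps.differentiable_π.continuousOn.comp
      (Continuous.continuousOn ((hL.continuous.comp continuous_snd).prodMk continuous_const)) hmapsI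
  have hV_cont : ContinuousOn (fun z : Vec n × Vec m => V z.1 (φ z.2) w) S :=
    (hVdiff w).continuousOn.comp (f := fun z : Vec n × Vec m => (z.1, φ z.2))
      (Continuous.continuousOn (continuous_fst.prodMk (hL.continuous.comp continuous_snd)))
      (fun z hz => hz)
  -- Plant error, average-price error and disagreement vanish together only at the equilibrium; this
  -- makes both `U` and its decay rate positive definite.
  have hsep : ∀ z ∈ S, z ≠ (π (u₀, w), σ • ones m) →
      ‖z.1 - π (φ z.2, w)‖ = 0 → ζ z.2 = σ → N z.2 ≠ 0 := by
    rintro ⟨x, η⟩ - hne hy hζ hN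
    have hη : η = σ • ones m := by
      have := hC.norm_sub_le η
      rw [hN, mul_zero, hζ] at this
      exact sub_eq_zero.1 (norm_le_zero_iff.1 this)
    refine hne (Prod.ext ?_ hη)
    have := sub_eq_zero.1 (norm_eq_zero.1 hy)
    dsimp only at this ⊢
    rw [this, hη]
  refine isAsymptoticallyStable_of_decreasesAlong (U := U) (N := Q)
    (hSopen.mem_nhds ⟨hps.mapsTo_π hI, hI⟩) hM ?_ ?_ ?_ ?_ ?_ ?_ ?_
  · exact (hV_cont.add (Continuous.continuousOn
      ((hdual_cont.comp (ζ.continuous.comp continuous_snd)).sub continuous_const))).add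
      (Continuous.continuousOn (continuous_const.mul ((hN_cont.comp continuous_snd).pow 2)))
  · have hV0 : V (π (u₀, w)) u₀ w = 0 := by
      obtain ⟨h1, -, h2, -⟩ := hV _ (hps.mapsTo_π hI) u₀ w hI
      rw [sub_self, norm_zero, zero_pow two_ne_zero, mul_zero] at h2
      exact le_antisymm h2 h1
    simp [hU, compositeLyapunov, hζe, hNe, ← hφ, ← hu₀, hV0]
  · intro z hz hne
    obtain ⟨-, h1, -⟩ := hV z.1 hz.1 (φ z.2) w hz.2
    have h2 : ζ z.2 ≠ σ → negDual lo hi J (d w) σ < negDual lo hi J (d w) (ζ z.2) :=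
      lt_of_hasDerivAt_of_strictMono hdual (strictMono_imbalance hψ) hσ
    have hN0 := mul_nonneg hκ0.le (sq_nonneg (N z.2))
    have hy0 := mul_nonneg hc₁.le (sq_nonneg ‖z.1 - π (φ z.2, w)‖)
    simp only [hU, compositeLyapunov, ← hφ]
    by_cases hζ : ζ z.2 = σ
    · rw [hζ, sub_self, add_zero]
      by_cases hy : ‖z.1 - π (φ z.2, w)‖ = 0
      · have := mul_pos hκ0 (pow_pos (lt_of_le_of_ne (apply_nonneg N z.2)
          (hsep z hz hne hy hζ).symm) 2)
        linarith
      · have := mul_pos hc₁ (pow_pos (lt_of_le_of_ne (norm_nonneg _) (Ne.symm hy)) 2)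
        linarith
    · linarith [h2 hζ]
  · have hR_cont : Continuous fun z : Vec n × Vec m => imbalance ψ (d w) (ζ z.2) :=
      (continuous_imbalance hψ).comp (ζ.continuous.comp continuous_snd)
    exact ((continuousOn_const.mul ((continuous_fst.continuousOn.sub hπ_cont).norm.pow 2)).add
      (Continuous.continuousOn (continuous_const.mul (hR_cont.abs.pow 2)))).add
      (Continuous.continuousOn (continuous_const.mul ((hN_cont.comp continuous_snd).pow 2)))
  · simp only [hQ, compositeRate]
    positivity
  · intro z hz hne
    simp only [hQ, compositeRate, ← hφ]
    have a₁ : 0 < c₃ / 2 := by positivity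
    have a₂ : 0 < ε / (2 * β) := by positivity
    have a₃ : 0 < ε * κ * c / 2 := by positivity
    have b₁ := mul_nonneg a₁.le (sq_nonneg ‖z.1 - π (φ z.2, w)‖)
    have b₂ := mul_nonneg a₂.le (sq_nonneg |imbalance ψ (d w) (ζ z.2)|)
    have b₃ := mul_nonneg a₃.le (sq_nonneg (N z.2))
    by_cases hζ : ζ z.2 = σ
    · by_cases hy : ‖z.1 - π (φ z.2, w)‖ = 0
      · have := mul_pos a₃ (pow_pos (lt_of_le_of_ne (apply_nonneg N z.2)
          (hsep z hz hne hy hζ).symm) 2)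
        linarith
      · have := mul_pos a₁ (pow_pos (lt_of_le_of_ne (norm_nonneg _) (Ne.symm hy)) 2)
        linarith
    · have hR : imbalance ψ (d w) (ζ z.2) ≠ 0 := fun h0 =>
        hζ ((strictMono_imbalance hψ (d := d w)).injective (h0.trans hσ.symm))
      have := mul_pos a₂ (pow_pos (abs_pos.2 hR) 2)
      linarith
  · intro z t hzt hz
    obtain ⟨hx, hη⟩ : HasDerivWithinAt (fun s => (z s).1)
        (closedLoop f h G lo hi J w τ (z t)).1 (Ici t) t ∧ HasDerivWithinAt (fun s => (z s).2)
        (closedLoop f h G lo hi J w τ (z t)).2 (Ici t) t :=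
      ⟨(ContinuousLinearMap.fst ℝ (Vec n) (Vec m)).hasFDerivAt.comp_hasDerivWithinAt t hz,
        (ContinuousLinearMap.snd ℝ (Vec n) (Vec m)).hasFDerivAt.comp_hasDerivWithinAt t hz⟩
    obtain ⟨hb₁, hb₂, hb₃⟩ := hbounds τ hτ0 (z t).1 (z t).2 hzt
    rw [Prod.mk.eta] at hb₁ hb₂ hb₃
    set y := ‖(z t).1 - π (φ (z t).2, w)‖ with hy
    set R := imbalance ψ (d w) (ζ (z t).2) with hR
    set η' := (closedLoop f h G lo hi J w τ (z t)).2 with hη'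
    obtain ⟨-, -, -, hV₁, hV₂⟩ := hV (z t).1 hzt.1 (φ (z t).2) w hzt.2
    have hopen : IsOpen {p : Vec n × Vec m | p.1 ∈ X ∧ (p.2, w) ∈ I} :=
      (hps.isOpen_X.preimage continuous_fst).inter (hps.isOpen_I.preimage (by fun_prop))
    obtain ⟨D, hD, hD₁, hD₂⟩ := exists_fderiv_prod (Φ := fun x u => V x u w)
      (((hVdiff w).contDiffAt (x := ((z t).1, φ (z t).2)) (hopen.mem_nhds hzt)).differentiableAt
        one_ne_zero)
    -- As `∇J*` is only Lipschitz, the contribution of `∇ᵤV` enters through its norm.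
    have d₁ := UpperDini.comp_prodMk_lipschitz hD hL hx hη
    have d₂ : UpperDini (fun s => negDual lo hi J (d w) (ζ (z s).2) - negDual lo hi J (d w) σ) t
        (R * ζ η') :=
      UpperDini.of_hasDerivWithinAt (((hdual (ζ (z t).2)).comp_hasDerivWithinAt t
        (ζ.hasFDerivAt.comp_hasDerivWithinAt t hη)).sub_const _)
    have d₃ : UpperDini (fun s => N (z s).2) t (ε * (-c * N (z t).2 + A * y)) := by
      refine UpperDini.seminorm_comp hCpos.le hC.seminorm_le hη ?_
      have hpos : 0 < s₀ * τ := mul_pos hC.s₀_pos hτ0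
      filter_upwards [self_mem_nhdsWithin,
        nhdsWithin_le_nhds (Iio_mem_nhds (show t < t + s₀ * τ by linarith))] with s h1 h2
      exact hb₃ (s - t) ⟨sub_nonneg.2 (le_of_lt h1), by linarith [mem_Iio.1 h2]⟩
    have d₄ := (d₃.sq (fun s => apply_nonneg _ _)
      (hN_cont.continuousAt.comp_continuousWithinAt hη.continuousWithinAt)).const_mul hκ0.le
    refine ((d₁.add d₂).add d₄).mono ?_
    have hrate := composite_rate_le (c₃ := c₃) (y := y) (R := |R|) (E := N (z t).2) hβ hc hκ0 hε0
      (show β * A ^ 2 ≤ κ * c by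
        rw [hκ, add_mul, div_mul_cancel₀ _ hc.ne']; linarith) hεc
    refine le_trans ?_ hrate
    refine add_le_add (add_le_add ?_ hb₂) le_rfl
    rw [hD₁, hD₂]
    refine add_le_add hV₁ ?_
    calc _ ≤ c₄ * y * (L * (τ⁻¹ * (A * (|R| + N (z t).2 + y)))) := by gcongr
      _ = _ := by rw [hB, hε]; ring

end Stability

end DAPI

theorem theorem1 {n m q : ℕ}
    -- the power system, with constant exogenous signal `w`
    (f : DAPI.Vec n → DAPI.Vec m → DAPI.Vec q → DAPI.Vec n)
    (h : DAPI.Vec n → DAPI.Vec m → DAPI.Vec q → DAPI.Vec m)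
    (X : Set (DAPI.Vec n)) (I : Set (DAPI.Vec m × DAPI.Vec q))
    (π : DAPI.Vec m × DAPI.Vec q → DAPI.Vec n) (β : ℝ) (d : DAPI.Vec q → ℝ)
    (hps : DAPI.PowerSystemAssumption f h X I π β d)
    (w : DAPI.Vec q)
    -- the costs
    (lo hi : Fin m → EReal) (J : Fin m → ℝ → ℝ)
    (hJ : ∀ i, DAPI.CostAssumption (lo i) (hi i) (J i))
    -- the resource-allocation problem is strictly feasible
    (hfeas : ∃ u, DAPI.IsFeasible lo hi (d w) u)
    -- an optimal operating point lies in the domain of the power system model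
    (hdom : ∀ u, DAPI.IsOptimizer lo hi J (d w) u → (u, w) ∈ I)
    -- the communication digraph
    (G : DAPI.WeightedDigraph m) (hG : ∃ i, G.GloballyReachable i) :
    -- the conjugates are finite and differentiable, so that the controller is well defined
    (∀ i, (∀ p, BddAbove (DAPI.conjValues (lo i) (hi i) (J i) p)) ∧
      Differentiable ℝ (DAPI.conj (lo i) (hi i) (J i))) ∧
    ∃ τstar > 0, ∀ τ ≥ τstar, ∃ p : DAPI.Vec n × DAPI.Vec m,
      DAPI.IsEquilibrium f h X I G lo hi J w τ p ∧
      (∀ p', DAPI.IsEquilibrium f h X I G lo hi J w τ p' → p' = p) ∧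
      DAPI.IsAsymptoticallyStable (DAPI.closedLoop f h G lo hi J w τ) p ∧
      DAPI.IsOptimizer lo hi J (d w) (DAPI.gradConj lo hi J p.2) ∧
      (∀ u, DAPI.IsOptimizer lo hi J (d w) u → u = DAPI.gradConj lo hi J p.2) := by
  choose ψ K hψ using fun i => (hJ i).exists_isInverseMarginal
  -- A globally reachable node exists, so there is at least one; without nodes the imbalance would
  -- not be strictly increasing.
  have : NeZero m := ⟨by rintro rfl; exact hG.choose.elim0⟩
  obtain ⟨N, ζ, c, s₀, C, hC⟩ := DAPI.WeightedDigraph.exists_consensusData hG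
  obtain ⟨σ, hσ⟩ := DAPI.exists_imbalance_eq_zero hψ hfeas
  obtain ⟨hopt, huniq⟩ := DAPI.isOptimizer_gradConj hJ hψ hσ
  have hI := hdom _ hopt
  obtain ⟨τstar, hτstar, hstable⟩ := DAPI.exists_isAsymptoticallyStable hps hC hψ hσ hI
  refine ⟨fun i => ⟨fun p => ⟨_, ((hψ i).isGreatest p).2⟩,
    fun p => ((hψ i).hasDerivAt_conj p).differentiableAt⟩, τstar, hτstar, fun τ hτ =>
    ⟨_, DAPI.isEquilibrium_smul_ones hps hC hψ hσ hI τ, fun p' hp' =>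
      hp'.eq hps hC hψ hσ (hτstar.trans_le hτ), hstable τ hτ, hopt, huniq⟩⟩
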